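/- Let $n\ge 1$ and let $\gamma_{-1}$ be the inverse Gaussian measure on $\mathbb{R}^n$, with Lebesgue density $\pi^{n/2}e^{|x|^2}$. For $k=(k_1,\dots,k_n)\in\mathbb{N}^n$ (with $0\in\mathbb{N}$) put $|k|=k_1+\dots+k_n$ and $\widetilde H_k(x)=e^{-|x|^2}\prod_{i=1}^n H_{k_i}(x_i)$, where $H_m(z)=(-1)^m e^{z^2}\frac{d^m}{dz^m}e^{-z^2}$; these functions are eigenfunctions, with eigenvalues $|k|+n$, of the closure $\mathcal{A}$ in $L^2(\mathbb{R}^n,\gamma_{-1})$ of the operator $-\frac12\Delta-x\cdot\nabla$ on $C_c^\infty(\mathbb{R}^n)$. For $\beta>0$ the negative power $\mathcal{A}^{-\beta}$ is the operator on $L^2(\mathbb{R}^n,\gamma_{-1})$ given by $$\mathcal{A}^{-\beta}f=\sum_{k\in\mathbb{N}^n}\frac{c_k(f)}{(|k|+n)^{\beta}}\,\widetilde H_k,\qquad c_k(f)=\frac{\pi^{n/2}}{\|\widetilde H_k\|_{L^2(\mathbb{R}^n,\gamma_{-1})}^2}\int_{\mathbb{R}^n}f(y)\widetilde H_k(y)e^{|y|^2}\,dy,$$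 where the series converges (unconditionally) in $L^2(\mathbb{R}^n,\gamma_{-1})$. Then, for every $\beta>0$: (i) for every $1<p<\infty$, $\mathcal{A}^{-\beta}$ can be extended from $L^p(\mathbb{R}^n,\gamma_{-1})\cap L^2(\mathbb{R}^n,\gamma_{-1})$ to $L^p(\mathbb{R}^n,\gamma_{-1})$ as a bounded linear operator from $L^p(\mathbb{R}^n,\gamma_{-1})$ into itself; (ii) $\mathcal{A}^{-\beta}$ can be extended from $L^1(\mathbb{R}^n,\gamma_{-1})\cap L^2(\mathbb{R}^n,\gamma_{-1})$ to $L^1(\mathbb{R}^n,\gamma_{-1})$ as a bounded linear operator from $L^1(\mathbb{R}^n,\gamma_{-1})$ into $L^{1,\infty}(\mathbb{R}^n,\gamma_{-1})$; that is, there are a linear extension $T$ and a constant $C$ with $\gamma_{-1}(\{x:|Tf(x)|>s\})\le \frac{C}{s}\|f\|_{L^1(\mathbb{R}^n,\gamma_{-1})}$ for all $f\in L^1(\mathbb{R}^n,\gamma_{-1})$ and $s>0$. -/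

import Mathlib

open MeasureTheory
open scoped ENNReal NNReal

namespace InverseGauss

noncomputable section

/-- The inverse Gaussian measure `γ₋₁` on `ℝⁿ`, with Lebesgue density `π^(n/2) e^{|x|²}`. -/
def gammaInv (n : ℕ) : Measure (EuclideanSpace ℝ (Fin n)) :=
  volume.withDensity fun x => ENNReal.ofReal (Real.pi ^ ((n : ℝ) / 2) * Real.exp (‖x‖ ^ 2))

/-- The one-dimensional Hermite polynomial `H_m(z) = (-1)^m e^{z²} (d/dz)^m e^{-z²}`. -/
def hermite1 (m : ℕ) (z : ℝ) : ℝ :=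
  (-1) ^ m * Real.exp (z ^ 2) * iteratedDeriv m (fun w : ℝ => Real.exp (-w ^ 2)) z

/-- The `n`-dimensional Hermite polynomial `H_k(x) = ∏ᵢ H_{kᵢ}(xᵢ)`. -/
def hermiteN {n : ℕ} (k : Fin n → ℕ) (x : EuclideanSpace ℝ (Fin n)) : ℝ :=
  ∏ i, hermite1 (k i) (x i)

/-- The function `e^{-|x|²} H_k(x)`. -/
def hermiteTilde {n : ℕ} (k : Fin n → ℕ) (x : EuclideanSpace ℝ (Fin n)) : ℝ :=
  Real.exp (-‖x‖ ^ 2) * hermiteN k x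

theorem hermite1_eq_poly (m : ℕ) : ∃ P : Polynomial ℝ, ∀ z, hermite1 m z = P.eval z := by
  have key : ∃ P : Polynomial ℝ, iteratedDeriv m (fun w : ℝ => Real.exp (-w ^ 2)) =
      fun z => P.eval z * Real.exp (-z ^ 2) := by
    induction m with
    | zero => exact ⟨1, by ext z; simp⟩
    | succ m ih =>
      obtain ⟨P, hP⟩ := ih
      refine ⟨Polynomial.derivative P - 2 * Polynomial.X * P, ?_⟩
      rw [iteratedDeriv_succ, hP]
      ext z
      have h1 : HasDerivAt (fun z : ℝ => Real.exp (-z ^ 2))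
          (Real.exp (-z ^ 2) * (-(2 * z))) z := by
        have h2 : HasDerivAt (fun z : ℝ => -z ^ 2) (-(2 * z)) z := by
          have h4 := (hasDerivAt_pow 2 z).fun_neg
          norm_num at h4
          exact h4
        exact h2.exp
      have h3 := ((P.hasDerivAt z).mul h1).deriv
      refine Eq.trans h3 ?_
      simp
      ring
  obtain ⟨P, hP⟩ := key
  refine ⟨Polynomial.C ((-1) ^ m) * P, fun z => ?_⟩
  have h : Real.exp (z ^ 2) * Real.exp (-z ^ 2) = 1 := by
    rw [← Real.exp_add]; simp
  rw [hermite1, hP, Polynomial.eval_mul, Polynomial.eval_C]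
  linear_combination (-1) ^ m * P.eval z * h

theorem integrable_poly_mul_gaussian (P : Polynomial ℝ) :
    Integrable fun z : ℝ => P.eval z * Real.exp (-z ^ 2) := by
  induction P using Polynomial.induction_on' with
  | add p q hp hq =>
    refine (hp.add hq).congr (Filter.Eventually.of_forall fun z => ?_)
    simp [add_mul]
  | monomial m a =>
    have h := (integrable_rpow_mul_exp_neg_mul_sq (b := 1) one_pos
      (s := m) (by linarith [(Nat.cast_nonneg m : (0 : ℝ) ≤ m)])).const_mul a
    simpa [mul_assoc] using h

theorem continuous_hermiteTilde {n : ℕ} (k : Fin n → ℕ) : Continuous (hermiteTilde k) := by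
  have h : ∀ m, Continuous (hermite1 m) := fun m => by
    obtain ⟨P, hP⟩ := hermite1_eq_poly m
    rw [funext hP]
    exact P.continuous
  unfold hermiteTilde hermiteN
  refine Continuous.mul (by fun_prop) (continuous_finsetProd _ fun i _ => ?_)
  exact (h _).comp (by fun_prop)

theorem integrable_hermiteTilde_sq {n : ℕ} (k : Fin n → ℕ) :
    Integrable (fun x => hermiteTilde k x ^ 2) (gammaInv n) := by
  have h1 : Integrable (fun x : Fin n → ℝ =>
      ∏ i, (hermite1 (k i) (x i) ^ 2 * Real.exp (-(x i) ^ 2))) volume := by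
    refine Integrable.fintype_prod (f := fun i z => hermite1 (k i) z ^ 2 * Real.exp (-z ^ 2))
      fun i => ?_
    obtain ⟨P, hP⟩ := hermite1_eq_poly (k i)
    refine (integrable_poly_mul_gaussian (P ^ 2)).congr (Filter.Eventually.of_forall fun z => ?_)
    simp only [hP, Polynomial.eval_pow]
  have h2 := ((PiLp.volume_preserving_ofLp (Fin n)).integrable_comp
    h1.aestronglyMeasurable).2 h1
  have h3 := h2.const_mul (Real.pi ^ ((n : ℝ) / 2))
  unfold gammaInv
  rw [integrable_withDensity_iff (by fun_prop) (by simp)]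
  refine h3.congr (Filter.Eventually.of_forall fun x => ?_)
  have hpos : 0 ≤ Real.pi ^ ((n : ℝ) / 2) * Real.exp (‖x‖ ^ 2) := by positivity
  have hn : ∏ i, Real.exp (-(x i) ^ 2) = Real.exp (-‖x‖ ^ 2) := by
    rw [← Real.exp_sum, EuclideanSpace.real_norm_sq_eq]
    simp
  have hc : Real.exp (-‖x‖ ^ 2) * Real.exp (‖x‖ ^ 2) = 1 := by
    rw [← Real.exp_add]; simp
  simp only [Function.comp_apply, hermiteTilde, hermiteN, ENNReal.toReal_ofReal hpos,
    Finset.prod_mul_distrib, hn, Finset.prod_pow]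
  linear_combination (-(Real.pi ^ ((n : ℝ) / 2)) * Real.exp (-‖x‖ ^ 2) *
    (∏ i, hermite1 (k i) (x i)) ^ 2) * hc

variable (𝕜 : Type*) [RCLike 𝕜] {n : ℕ}

theorem memLp_hermiteTilde (k : Fin n → ℕ) :
    MemLp (fun x => ((hermiteTilde k x : ℝ) : 𝕜)) 2 (gammaInv n) :=
  ((memLp_two_iff_integrable_sq (continuous_hermiteTilde k).aestronglyMeasurable).2
    (integrable_hermiteTilde_sq k)).ofReal

/-- The function `e^{-|x|²} H_k(x)` as an element of `L²(γ₋₁)`. -/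
def hermiteL2 (k : Fin n → ℕ) : Lp 𝕜 2 (gammaInv n) :=
  (memLp_hermiteTilde 𝕜 k).toLp _

variable {𝕜}

/-- The coefficient `c_k(f) = π^(n/2) ‖H̃_k‖⁻² ∫ f(y) H̃_k(y) e^{|y|²} dy`, where
`H̃_k(y) = e^{-|y|²} H_k(y)` and the norm is that of `L²(γ₋₁)`. -/
def coeff (f : Lp 𝕜 2 (gammaInv n)) (k : Fin n → ℕ) : 𝕜 :=
  ((Real.pi ^ ((n : ℝ) / 2) / ‖hermiteL2 𝕜 k‖ ^ 2 : ℝ) : 𝕜) *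
    ∫ y, f y * ((hermiteTilde k y * Real.exp (‖y‖ ^ 2) : ℝ) : 𝕜)

/-- The `k`-th term `c_k(f) (|k| + n)^{-β} H̃_k` of the series that defines `𝒜^{-β} f`. -/
def negPowTerm (β : ℝ) (f : Lp 𝕜 2 (gammaInv n)) (k : Fin n → ℕ) : Lp 𝕜 2 (gammaInv n) :=
  (coeff f k / (((((∑ i, k i : ℕ) : ℝ) + n) ^ β : ℝ) : 𝕜)) • hermiteL2 𝕜 k

/-- The negative power `𝒜^{-β} f = ∑_k c_k(f) (|k| + n)^{-β} H̃_k` on `L²(γ₋₁)`; the (unordered)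
series is taken in the norm of `L²(γ₋₁)`. -/
def negPow (β : ℝ) (f : Lp 𝕜 2 (gammaInv n)) : Lp 𝕜 2 (gammaInv n) :=
  ∑' k : Fin n → ℕ, negPowTerm β f k

end

end InverseGauss

/-!
The identity `𝒜^{-β} = Γ(β)⁻¹ ∫₀^∞ t^(β-1) e^{-t𝒜} dt` gives `𝒜^{-β}` a positive kernel with
respect to `γ₋₁`, obtained by integrating the Mehler kernel of `e^{-t𝒜}`, and the extensions of
`𝒜^{-β}` are the integral operators with this kernel.

For `1 < p < ∞` the kernel satisfies Schur's test with Gaussian weights, because `e^{-t𝒜}` maps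
`e^{-a|x|²}`, `0 < a ≤ 1`, below a fixed multiple of `e^{-nt} e^{-a|x|²}`. For the weak type
`(1, 1)` the times `t ≤ 1` and `t > 1` are separated. The kernel of `e^{-t𝒜}` has total mass one, so
that the small times give a bounded operator on `L¹(γ₋₁)`. The large times are dominated by
`e^{-|x|²}` times a potential that is homogeneous of degree `-(n - 1/2)`, whose superlevel sets
are intervals on every ray; their measure is computed in polar coordinates.

On `L²(γ₋₁)` the kernel operator is the series, since by Mehler's formula `e^{-t𝒜}` multiplies
`H̃_k` by `e^{-(|k|+n)t}`, and `t^(β-1) dt / Γ(β)` integrates this to `(|k|+n)^{-β}`. The `H̃_k`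
are complete because a function orthogonal to all of them has a Gaussian multiple whose Fourier
transform, expanded in moments, vanishes.
-/

namespace InverseGauss

noncomputable section

open Real Set

section KernelOperators

variable {X Y F 𝕂 : Type*} [MeasurableSpace Y] {ν : Measure Y} {K : X → Y → ℝ≥0∞}
  [NormedAddCommGroup F] [NormedSpace ℝ F] [NormedField 𝕂] [NormedSpace 𝕂 F] [SMulCommClass ℝ 𝕂 F]

/-- The integral operator with kernel `K`, acting on functions with values in `[0, ∞]`. -/
def lintegralOp (ν : Measure Y) (K : X → Y → ℝ≥0∞) (f : Y → ℝ≥0∞) (x : X) : ℝ≥0∞ :=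
  ∫⁻ y, K x y * f y ∂ν

/-- The integral operator with kernel `K`, acting on vector-valued functions. An infinite value of
`K` is read as `0`; when `lintegralOp ν K ‖f‖ₑ x < ∞` this affects only a null subset of
`{y | f y ≠ 0}`. -/
def integralOp (ν : Measure Y) (K : X → Y → ℝ≥0∞)
    (f : Y → F) (x : X) : F :=
  ∫ y, (K x y).toReal • f y ∂ν

theorem lintegral_rpow_le_of_weight {ρ : Measure Y} {p q : ℝ} (hpq : p.HolderConjugate q)
    {w f : Y → ℝ≥0∞} (hw : Measurable w) (hw0 : ∀ y, w y ≠ 0) (hwt : ∀ y, w y ≠ ∞)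
    (hf : Measurable f) :
    (∫⁻ y, f y ∂ρ) ^ p ≤ (∫⁻ y, w y ^ q ∂ρ) ^ (p - 1) * ∫⁻ y, w y ^ (-p) * f y ^ p ∂ρ := by
  have hp := hpq.pos
  have hsplit : ∀ y, w y * ((w y)⁻¹ * f y) = f y := fun y => by
    rw [← mul_assoc, ENNReal.mul_inv_cancel (hw0 y) (hwt y), one_mul]
  have hpow : ∀ y, ((w y)⁻¹ * f y) ^ p = w y ^ (-p) * f y ^ p := fun y => by
    rw [ENNReal.mul_rpow_of_nonneg _ _ hp.le, ENNReal.inv_rpow, ENNReal.rpow_neg]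
  have holder := ENNReal.lintegral_mul_le_Lp_mul_Lq ρ hpq.symm hw.aemeasurable
    (hw.inv.mul hf).aemeasurable
  simp only [Pi.inv_apply, Pi.mul_apply, hsplit, hpow] at holder
  calc (∫⁻ y, f y ∂ρ) ^ p
      ≤ ((∫⁻ y, w y ^ q ∂ρ) ^ (1 / q) * (∫⁻ y, w y ^ (-p) * f y ^ p ∂ρ) ^ (1 / p)) ^ p :=
        ENNReal.rpow_le_rpow holder hp.le
    _ = _ := by
        rw [ENNReal.mul_rpow_of_nonneg _ _ hp.le, ← ENNReal.rpow_mul, ← ENNReal.rpow_mul,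
          one_div_mul_cancel hp.ne', ENNReal.rpow_one, one_div_mul_eq_div,
          hpq.div_conj_eq_sub_one]

theorem enorm_toReal_smul_le (a : ℝ≥0∞) (v : F) : ‖a.toReal • v‖ₑ ≤ a * ‖v‖ₑ := by
  rw [enorm_smul, Real.enorm_of_nonneg ENNReal.toReal_nonneg]
  gcongr
  exact ENNReal.ofReal_toReal_le

theorem enorm_integralOp_le (f : Y → F) (x : X) :
    ‖integralOp ν K f x‖ₑ ≤ lintegralOp ν K (fun y => ‖f y‖ₑ) x :=
  (enorm_integral_le_lintegral_enorm _).trans (lintegral_mono fun _ => enorm_toReal_smul_le _ _)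

theorem integralOp_congr_ae {f g : Y → F} (h : f =ᵐ[ν] g) :
    integralOp ν K f = integralOp ν K g := by
  ext x
  refine integral_congr_ae ?_
  filter_upwards [h] with y hy
  rw [hy]

theorem integralOp_const_smul (c : 𝕂) (f : Y → F) :
    integralOp ν K (c • f) = c • integralOp ν K f := by
  ext x
  simp only [integralOp, Pi.smul_apply, smul_comm _ c]
  exact integral_smul c _

theorem integralOp_coeFn_const_smul {p : ℝ≥0∞} (c : 𝕂) (f : Lp F p ν) :
    integralOp ν K (c • f : Lp F p ν) = c • integralOp ν K f := by
  rw [integralOp_congr_ae (Lp.coeFn_smul c f), integralOp_const_smul]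

variable [MeasurableSpace X] {μ : Measure X} {p : ℝ≥0∞}

/-- The operator with kernel `K` is of strong type `(p, p)` with constant `C`. -/
def HasStrongType (μ : Measure X) (ν : Measure Y) (K : X → Y → ℝ≥0∞) (p : ℝ≥0∞) (C : ℝ≥0) : Prop :=
  ∀ f : Y → ℝ≥0∞, Measurable f → eLpNorm (lintegralOp ν K f) p μ ≤ C * eLpNorm f p ν

/-- The operator with kernel `K` is of weak type `(1, 1)` with constant `C`. -/
def HasWeakTypeOne (μ : Measure X) (ν : Measure Y) (K : X → Y → ℝ≥0∞) (C : ℝ≥0) : Prop :=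
  ∀ f : Y → ℝ≥0∞, Measurable f → ∀ s : ℝ≥0, s ≠ 0 →
    μ {x | s < lintegralOp ν K f x} ≤ C / s * ∫⁻ y, f y ∂ν

theorem measurable_lintegralOp [SFinite ν] (hK : Measurable (Function.uncurry K)) {f : Y → ℝ≥0∞}
    (hf : Measurable f) : Measurable (lintegralOp ν K f) :=
  Measurable.lintegral_prod_right (f := fun x y => K x y * f y)
    (hK.mul (hf.comp measurable_snd))

theorem lintegral_mul_lintegralOp [SFinite μ] [SFinite ν] (hK : Measurable (Function.uncurry K))
    {u : X → ℝ≥0∞} (hu : Measurable u) {g : Y → ℝ≥0∞} (hg : Measurable g) :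
    ∫⁻ x, u x * lintegralOp ν K g x ∂μ =
      ∫⁻ y, lintegralOp μ (Function.swap K) u y * g y ∂ν := by
  have hKx : ∀ x, Measurable (K x) := fun x => hK.comp measurable_prodMk_left
  have hKy : ∀ y, Measurable fun x => K x y := fun y => hK.comp measurable_prodMk_right
  calc ∫⁻ x, u x * lintegralOp ν K g x ∂μ = ∫⁻ x, ∫⁻ y, u x * (K x y * g y) ∂ν ∂μ :=
        lintegral_congr fun x => (lintegral_const_mul _ ((hKx x).mul hg)).symm
    _ = ∫⁻ y, ∫⁻ x, u x * (K x y * g y) ∂μ ∂ν :=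
        lintegral_lintegral_swap ((hu.comp measurable_fst).mul
          (hK.mul (hg.comp measurable_snd))).aemeasurable
    _ = ∫⁻ y, lintegralOp μ (Function.swap K) u y * g y ∂ν := by
        refine lintegral_congr fun y => ?_
        rw [lintegralOp, ← lintegral_mul_const _ (by exact (hKy y).mul hu)]
        exact lintegral_congr fun x => by rw [Function.swap]; ring

theorem lintegralOp_rpow_le_of_weight (hK : Measurable (Function.uncurry K)) {p q : ℝ}
    (hpq : p.HolderConjugate q) {w f : Y → ℝ≥0∞} (hw : Measurable w) (hw0 : ∀ y, w y ≠ 0)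
    (hwt : ∀ y, w y ≠ ∞) (hf : Measurable f) (x : X) :
    lintegralOp ν K f x ^ p ≤ lintegralOp ν K (fun y => w y ^ q) x ^ (p - 1) *
      lintegralOp ν K (fun y => w y ^ (-p) * f y ^ p) x := by
  have h := lintegral_rpow_le_of_weight (ρ := ν.withDensity (K x)) hpq hw hw0 hwt hf
  have hKx : Measurable (K x) := hK.comp measurable_prodMk_left
  rwa [lintegral_withDensity_eq_lintegral_mul _ hKx hf,
    lintegral_withDensity_eq_lintegral_mul _ hKx (by fun_prop),
    lintegral_withDensity_eq_lintegral_mul _ hKx (by fun_prop)] at h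

theorem lintegral_lintegralOp_rpow_le_of_schur [SFinite μ] [SFinite ν]
    (hK : Measurable (Function.uncurry K)) {p q : ℝ} (hpq : p.HolderConjugate q)
    {u : X → ℝ≥0∞} {w : Y → ℝ≥0∞} (hu : Measurable u) (hw : Measurable w) (hw0 : ∀ y, w y ≠ 0)
    (hwt : ∀ y, w y ≠ ∞) {C : ℝ≥0∞}
    (hq : ∀ x, lintegralOp ν K (fun y => w y ^ q) x ≤ C * u x ^ q)
    (hp : ∀ y, lintegralOp μ (Function.swap K) (fun x => u x ^ p) y ≤ C * w y ^ p)
    {f : Y → ℝ≥0∞} (hf : Measurable f) :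
    ∫⁻ x, lintegralOp ν K f x ^ p ∂μ ≤ C ^ p * ∫⁻ y, f y ^ p ∂ν := by
  have hp1 := hpq.sub_one_pos
  have hmeas := measurable_lintegralOp (ν := ν) hK
    (f := fun y => w y ^ (-p) * f y ^ p) (by fun_prop)
  have hcancel : ∀ y a, C * w y ^ p * (w y ^ (-p) * a) = C * a := fun y a => by
    rw [mul_assoc, ← mul_assoc (w y ^ p), ← ENNReal.rpow_add _ _ (hw0 y) (hwt y), add_neg_cancel,
      ENNReal.rpow_zero, one_mul]
  calc ∫⁻ x, lintegralOp ν K f x ^ p ∂μ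
      ≤ ∫⁻ x, (C * u x ^ q) ^ (p - 1) *
          lintegralOp ν K (fun y => w y ^ (-p) * f y ^ p) x ∂μ := by
        refine lintegral_mono fun x =>
          (lintegralOp_rpow_le_of_weight hK hpq hw hw0 hwt hf x).trans ?_
        gcongr
        exact hq x
    _ = C ^ (p - 1) * ∫⁻ x, u x ^ p * lintegralOp ν K (fun y => w y ^ (-p) * f y ^ p) x ∂μ := by
        rw [← lintegral_const_mul _ (by fun_prop)]
        refine lintegral_congr fun x => ?_
        rw [ENNReal.mul_rpow_of_nonneg _ _ hp1.le, ← ENNReal.rpow_mul, mul_comm q,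
          hpq.sub_one_mul_conj, mul_assoc]
    _ ≤ C ^ (p - 1) * ∫⁻ y, C * w y ^ p * (w y ^ (-p) * f y ^ p) ∂ν := by
        rw [lintegral_mul_lintegralOp hK (by fun_prop) (by fun_prop)]
        gcongr with y
        exact hp y
    _ = C ^ p * ∫⁻ y, f y ^ p ∂ν := by
        simp_rw [hcancel]
        rw [lintegral_const_mul _ (by fun_prop), ← mul_assoc]
        congr 1
        nth_rw 2 [← ENNReal.rpow_one C]
        rw [← ENNReal.rpow_add_of_nonneg _ _ hp1.le zero_le_one, sub_add_cancel]

theorem hasStrongType_of_lintegral_rpow_le (hp0 : p ≠ 0) (hp : p ≠ ∞) {C : ℝ≥0}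
    (h : ∀ f : Y → ℝ≥0∞, Measurable f → ∫⁻ x, lintegralOp ν K f x ^ p.toReal ∂μ ≤
      (C : ℝ≥0∞) ^ p.toReal * ∫⁻ y, f y ^ p.toReal ∂ν) :
    HasStrongType μ ν K p C := by
  intro f hf
  have hpos : 0 < p.toReal := ENNReal.toReal_pos hp0 hp
  rw [eLpNorm_eq_lintegral_rpow_enorm_toReal hp0 hp, eLpNorm_eq_lintegral_rpow_enorm_toReal hp0 hp]
  simp only [enorm_eq_self]
  calc _ ≤ ((C : ℝ≥0∞) ^ p.toReal * ∫⁻ y, f y ^ p.toReal ∂ν) ^ (1 / p.toReal) := by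
        gcongr
        exact h f hf
    _ = _ := by
        rw [ENNReal.mul_rpow_of_nonneg _ _ (by positivity), ← ENNReal.rpow_mul, mul_one_div,
          div_self hpos.ne', ENNReal.rpow_one]

theorem HasStrongType.ae_lintegralOp_lt_top [SFinite ν] {C : ℝ≥0}
    (h : HasStrongType μ ν K p C) (hK : Measurable (Function.uncurry K)) (hp0 : p ≠ 0) (hp : p ≠ ∞)
    {f : Y → ℝ≥0∞} (hf : Measurable f) (hfp : eLpNorm f p ν < ∞) :
    ∀ᵐ x ∂μ, lintegralOp ν K f x < ∞ := by
  have hlt := (h f hf).trans_lt (ENNReal.mul_lt_top ENNReal.coe_lt_top hfp)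
  rw [eLpNorm_lt_top_iff_lintegral_rpow_enorm_lt_top hp0 hp] at hlt
  simp only [enorm_eq_self] at hlt
  filter_upwards [ae_lt_top ((measurable_lintegralOp hK hf).pow_const _) hlt.ne] with x hx
  exact (ENNReal.rpow_lt_top_iff_of_pos (ENNReal.toReal_pos hp0 hp)).1 hx

theorem hasWeakTypeOne_of_lintegral_le [SFinite μ] [SFinite ν] {C : ℝ≥0}
    (hK : Measurable (Function.uncurry K)) (h : ∀ y, ∫⁻ x, K x y ∂μ ≤ C) :
    HasWeakTypeOne μ ν K C := fun f hf s hs => by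
  have hL1 : ∫⁻ x, lintegralOp ν K f x ∂μ ≤ C * ∫⁻ y, f y ∂ν := by
    have hswap := lintegral_mul_lintegralOp (μ := μ) (ν := ν) hK measurable_one hf
    simp only [Pi.one_apply, one_mul] at hswap
    rw [hswap, ← lintegral_const_mul _ hf]
    gcongr with y
    simpa [lintegralOp] using h y
  calc μ {x | s < lintegralOp ν K f x} ≤ μ {x | s ≤ lintegralOp ν K f x} :=
        measure_mono fun x (hx : s < lintegralOp ν K f x) => hx.le
    _ ≤ (∫⁻ x, lintegralOp ν K f x ∂μ) / s := meas_ge_le_lintegral_div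
        (measurable_lintegralOp hK hf).aemeasurable (by simpa using hs) ENNReal.coe_ne_top
    _ ≤ C * (∫⁻ y, f y ∂ν) / s := by gcongr
    _ = C / s * ∫⁻ y, f y ∂ν := by simp only [div_eq_mul_inv]; ring

theorem HasWeakTypeOne.of_le_add {K₁ K₂ : X → Y → ℝ≥0∞} {C₁ C₂ : ℝ≥0}
    (h₁ : HasWeakTypeOne μ ν K₁ C₁) (h₂ : HasWeakTypeOne μ ν K₂ C₂) (hK₁ : ∀ x, Measurable (K₁ x))
    (hle : ∀ x y, K x y ≤ K₁ x y + K₂ x y) :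
    HasWeakTypeOne μ ν K (2 * (C₁ + C₂)) := fun f hf s hs => by
  have hsum : ∀ x, lintegralOp ν K f x ≤ lintegralOp ν K₁ f x + lintegralOp ν K₂ f x := fun x => by
    rw [lintegralOp, lintegralOp, lintegralOp,
      ← lintegral_add_left (f := fun y => K₁ x y * f y) ((hK₁ x).mul hf)]
    refine lintegral_mono fun y => ?_
    rw [← add_mul]
    gcongr
    exact hle x y
  have hsub : {x | s < lintegralOp ν K f x} ⊆
      {x | (s / 2 : ℝ≥0) < lintegralOp ν K₁ f x} ∪ {x | (s / 2 : ℝ≥0) < lintegralOp ν K₂ f x} := by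
    intro x (hx : s < lintegralOp ν K f x)
    by_contra! hnot
    simp only [mem_union, mem_ofPred_eq, not_or, not_lt] at hnot
    have hxs := (hsum x).trans (add_le_add hnot.1 hnot.2)
    rw [← ENNReal.coe_add, add_halves] at hxs
    exact hxs.not_gt hx
  have hs2 : s / 2 ≠ 0 := div_ne_zero hs two_ne_zero
  calc μ {x | s < lintegralOp ν K f x} ≤ _ := measure_mono hsub
    _ ≤ _ := measure_union_le _ _
    _ ≤ C₁ / (s / 2 : ℝ≥0) * (∫⁻ y, f y ∂ν) + C₂ / (s / 2 : ℝ≥0) * ∫⁻ y, f y ∂ν :=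
        add_le_add (h₁ f hf _ hs2) (h₂ f hf _ hs2)
    _ = _ := by
        rw [← ENNReal.coe_div hs2, ← ENNReal.coe_div hs2, ← ENNReal.coe_div hs, ← add_mul,
          ← ENNReal.coe_add, ← add_div, div_div_eq_mul_div, mul_comm (C₁ + C₂)]

theorem HasWeakTypeOne.ae_lintegralOp_lt_top {C : ℝ≥0} (h : HasWeakTypeOne μ ν K C)
    {f : Y → ℝ≥0∞} (hf : Measurable f) (hfin : ∫⁻ y, f y ∂ν ≠ ∞) :
    ∀ᵐ x ∂μ, lintegralOp ν K f x < ∞ := by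
  have hbound : ∀ m : ℕ, μ {x | ¬ lintegralOp ν K f x < ∞} ≤
      (C * ∫⁻ y, f y ∂ν) * ((m + 1 : ℕ) : ℝ≥0∞)⁻¹ := fun m => by
    calc μ {x | ¬ lintegralOp ν K f x < ∞}
        ≤ μ {x | ((m + 1 : ℕ) : ℝ≥0) < lintegralOp ν K f x} :=
          measure_mono fun x hx => ENNReal.coe_lt_top.trans_le (not_lt.1 hx)
      _ ≤ C / ((m + 1 : ℕ) : ℝ≥0) * ∫⁻ y, f y ∂ν := h f hf _ (Nat.cast_ne_zero.2 m.succ_ne_zero)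
      _ = _ := by rw [div_eq_mul_inv, ENNReal.coe_natCast]; ring
  have hlim := ENNReal.Tendsto.const_mul (a := C * ∫⁻ y, f y ∂ν)
    (ENNReal.tendsto_inv_nat_nhds_zero.comp (Filter.tendsto_add_atTop_nat 1))
    (Or.inr (ENNReal.mul_ne_top ENNReal.coe_ne_top hfin))
  rw [mul_zero] at hlim
  exact ae_iff.2 (nonpos_iff_eq_zero.1 (ge_of_tendsto' hlim hbound))

theorem stronglyMeasurable_integralOp [SFinite ν] (hK : Measurable (Function.uncurry K))
    {f : Y → F} (hf : StronglyMeasurable f) : StronglyMeasurable (integralOp ν K f) :=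
  StronglyMeasurable.integral_prod_right (f := fun x y => (K x y).toReal • f y)
    (hK.ennreal_toReal.stronglyMeasurable.smul (hf.comp_measurable measurable_snd))

theorem integrable_toReal_smul (hK : Measurable (Function.uncurry K)) {f : Y → F}
    (hf : StronglyMeasurable f) {x : X} (hx : lintegralOp ν K (fun y => ‖f y‖ₑ) x < ∞) :
    Integrable (fun y => (K x y).toReal • f y) ν :=
  have hKx : Measurable (K x) := hK.comp measurable_prodMk_left
  ⟨(hKx.ennreal_toReal.stronglyMeasurable.smul hf).aestronglyMeasurable,
    (lintegral_mono fun _ => enorm_toReal_smul_le _ _).trans_lt hx⟩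

theorem integralOp_add (hK : Measurable (Function.uncurry K)) {f g : Y → F}
    (hf : StronglyMeasurable f) (hg : StronglyMeasurable g) {x : X}
    (hfx : lintegralOp ν K (fun y => ‖f y‖ₑ) x < ∞)
    (hgx : lintegralOp ν K (fun y => ‖g y‖ₑ) x < ∞) :
    integralOp ν K (f + g) x = integralOp ν K f x + integralOp ν K g x := by
  simp only [integralOp, Pi.add_apply, smul_add]
  exact integral_add (integrable_toReal_smul hK hf hfx) (integrable_toReal_smul hK hg hgx)

theorem integralOp_coeFn_add (hK : Measurable (Function.uncurry K)) (f g : Lp F p ν)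
    (hf : ∀ᵐ x ∂μ, lintegralOp ν K (fun y => ‖f y‖ₑ) x < ∞)
    (hg : ∀ᵐ x ∂μ, lintegralOp ν K (fun y => ‖g y‖ₑ) x < ∞) :
    integralOp ν K (f + g : Lp F p ν) =ᵐ[μ] integralOp ν K f + integralOp ν K g := by
  rw [integralOp_congr_ae (Lp.coeFn_add f g)]
  filter_upwards [hf, hg] with x hfx hgx
  exact integralOp_add hK (Lp.stronglyMeasurable f) (Lp.stronglyMeasurable g) hfx hgx

variable (𝕂 F)

theorem HasStrongType.exists_continuousLinearMap [SFinite ν] [Fact (1 ≤ p)] {C : ℝ≥0}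
    (h : HasStrongType μ ν K p C) (hK : Measurable (Function.uncurry K)) (hp : p ≠ ∞) :
    ∃ T : Lp F p ν →L[𝕂] Lp F p μ, ∀ f : Lp F p ν, T f =ᵐ[μ] integralOp ν K f := by
  have hp0 : p ≠ 0 := (zero_lt_one.trans_le Fact.out).ne'
  have hle : ∀ f : Lp F p ν, eLpNorm (integralOp ν K f) p μ ≤ C * eLpNorm f p ν := fun f =>
    ((eLpNorm_mono_enorm (enorm_integralOp_le f)).trans
      (h _ (Lp.stronglyMeasurable f).enorm)).trans_eq (by rw [eLpNorm_enorm])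
  have hmem : ∀ f : Lp F p ν, MemLp (integralOp ν K f) p μ := fun f =>
    ⟨(stronglyMeasurable_integralOp hK (Lp.stronglyMeasurable f)).aestronglyMeasurable,
      (hle f).trans_lt (ENNReal.mul_lt_top ENNReal.coe_lt_top (Lp.eLpNorm_lt_top f))⟩
  have hfin : ∀ f : Lp F p ν, ∀ᵐ x ∂μ, lintegralOp ν K (fun y => ‖f y‖ₑ) x < ∞ := fun f =>
    h.ae_lintegralOp_lt_top hK hp0 hp (Lp.stronglyMeasurable f).enorm
      ((eLpNorm_enorm f).trans_lt (Lp.eLpNorm_lt_top f))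
  let L : Lp F p ν →ₗ[𝕂] Lp F p μ :=
    { toFun := fun f => (hmem f).toLp _
      map_add' := fun f g => by
        rw [← MemLp.toLp_add, MemLp.toLp_eq_toLp_iff]
        exact integralOp_coeFn_add hK f g (hfin f) (hfin g)
      map_smul' := fun c f => by
        rw [RingHom.id_apply, ← MemLp.toLp_const_smul, MemLp.toLp_eq_toLp_iff,
          integralOp_coeFn_const_smul] }
  refine ⟨L.mkContinuous C fun f => ?_, fun f => (hmem f).coeFn_toLp⟩
  change ‖(hmem f).toLp _‖ ≤ _
  rw [Lp.norm_toLp, Lp.norm_def, ← ENNReal.coe_toReal, ← ENNReal.toReal_mul]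
  exact ENNReal.toReal_mono (ENNReal.mul_ne_top ENNReal.coe_ne_top (Lp.eLpNorm_ne_top f)) (hle f)

variable {F} in
theorem HasWeakTypeOne.measure_norm_integralOp_le {C : ℝ≥0} (h : HasWeakTypeOne μ ν K C)
    (f : Lp F 1 ν) {s : ℝ} (hs : 0 < s) :
    μ {x | s < ‖integralOp ν K f x‖} ≤ ENNReal.ofReal (C * ‖f‖ / s) := by
  calc μ {x | s < ‖integralOp ν K f x‖}
      ≤ μ {x | s.toNNReal < lintegralOp ν K (fun y => ‖f y‖ₑ) x} := by
        refine measure_mono fun x hx => lt_of_lt_of_le ?_ (enorm_integralOp_le f x)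
        rw [← ofReal_norm]
        exact (ENNReal.ofReal_lt_ofReal_iff (hs.trans hx)).2 hx
    _ ≤ C / s.toNNReal * ∫⁻ y, ‖f y‖ₑ ∂ν :=
        h _ (Lp.stronglyMeasurable f).enorm _ (by simpa using hs)
    _ = ENNReal.ofReal (C * ‖f‖ / s) := by
        rw [← eLpNorm_one_eq_lintegral_enorm, ← Lp.enorm_def, ← ofReal_norm, mul_div_right_comm,
          ENNReal.ofReal_mul (by positivity), ENNReal.ofReal_div_of_pos hs,
          ENNReal.ofReal_coe_nnreal]
        rfl

theorem HasWeakTypeOne.exists_linearMap [SFinite ν] {C : ℝ≥0} (h : HasWeakTypeOne μ ν K C)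
    (hK : Measurable (Function.uncurry K)) :
    ∃ T : Lp F 1 ν →ₗ[𝕂] (X →ₘ[μ] F),
      (∀ f : Lp F 1 ν, ∀ s : ℝ, 0 < s → μ {x | s < ‖T f x‖} ≤ ENNReal.ofReal (C * ‖f‖ / s)) ∧
      ∀ f : Lp F 1 ν, T f =ᵐ[μ] integralOp ν K f := by
  have hfin : ∀ f : Lp F 1 ν, ∀ᵐ x ∂μ, lintegralOp ν K (fun y => ‖f y‖ₑ) x < ∞ := fun f =>
    h.ae_lintegralOp_lt_top (Lp.stronglyMeasurable f).enorm
      (eLpNorm_one_eq_lintegral_enorm.symm.trans_ne (Lp.eLpNorm_ne_top f))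
  have hmeas : ∀ f : Lp F 1 ν, AEStronglyMeasurable (integralOp ν K f) μ := fun f =>
    (stronglyMeasurable_integralOp hK (Lp.stronglyMeasurable f)).aestronglyMeasurable
  let T : Lp F 1 ν →ₗ[𝕂] (X →ₘ[μ] F) :=
    { toFun := fun f => AEEqFun.mk _ (hmeas f)
      map_add' := fun f g => by
        rw [AEEqFun.mk_add_mk, AEEqFun.mk_eq_mk]
        exact integralOp_coeFn_add hK f g (hfin f) (hfin g)
      map_smul' := fun c f => by
        rw [RingHom.id_apply, AEEqFun.smul_mk, AEEqFun.mk_eq_mk, integralOp_coeFn_const_smul] }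
  have hT : ∀ f, T f =ᵐ[μ] integralOp ν K f := fun f => AEEqFun.coeFn_mk _ (hmeas f)
  refine ⟨T, fun f s hs => ?_, hT⟩
  refine (measure_mono_ae ?_).trans (h.measure_norm_integralOp_le f hs)
  filter_upwards [hT f] with x hx hxs
  exact (congrArg (s < ‖·‖) hx).mp hxs

end KernelOperators

section GaussianIntegral

variable {V : Type*} [NormedAddCommGroup V] [InnerProductSpace ℝ V] [FiniteDimensional ℝ V]
  [MeasurableSpace V] [BorelSpace V]

theorem integrable_exp_neg_mul_sq_norm {b : ℝ} (hb : 0 < b) :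
    Integrable fun v : V => exp (-b * ‖v‖ ^ 2) :=
  .of_integral_ne_zero (by rw [GaussianFourier.integral_rexp_neg_mul_sq_norm hb]; positivity)

theorem lintegral_exp_neg_mul_sq_norm_sub {b : ℝ} (hb : 0 < b) (w : V) :
    ∫⁻ v, ENNReal.ofReal (exp (-b * ‖v - w‖ ^ 2)) =
      ENNReal.ofReal (√(π / b) ^ Module.finrank ℝ V) := by
  rw [lintegral_sub_right_eq_self (fun v : V => ENNReal.ofReal (exp (-b * ‖v‖ ^ 2))) w,
    ← ofReal_integral_eq_lintegral_ofReal (integrable_exp_neg_mul_sq_norm hb)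
      (.of_forall fun _ => (exp_pos _).le),
    GaussianFourier.integral_rexp_neg_mul_sq_norm hb, rpow_div_two_eq_sqrt _ (by positivity),
    rpow_natCast]

end GaussianIntegral

local notation "E" n:max => EuclideanSpace ℝ (Fin n)

variable {n : ℕ}

section Measure

theorem pi_rpow_half (n : ℕ) : π ^ ((n : ℝ) / 2) = √π ^ n := by
  rw [rpow_div_two_eq_sqrt _ pi_pos.le, rpow_natCast]

instance : SigmaFinite (gammaInv n) :=
  SigmaFinite.withDensity_of_ne_top (by simp)

theorem lintegral_gammaInv (f : E n → ℝ≥0∞) :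
    ∫⁻ y, f y ∂(gammaInv n) = ∫⁻ y, ENNReal.ofReal (√π ^ n * exp (‖y‖ ^ 2)) * f y := by
  rw [gammaInv,
    lintegral_withDensity_eq_lintegral_mul_non_measurable _ (by fun_prop) (by simp)]
  simp only [Pi.mul_apply, pi_rpow_half]

theorem integral_gammaInv {F : Type*} [NormedAddCommGroup F] [NormedSpace ℝ F] (f : E n → F) :
    ∫ y, f y ∂(gammaInv n) = ∫ y, (√π ^ n * exp (‖y‖ ^ 2)) • f y := by
  rw [gammaInv, integral_withDensity_eq_integral_toReal_smul (by fun_prop) (by simp)]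
  refine integral_congr_ae (.of_forall fun y => ?_)
  dsimp only
  rw [ENNReal.toReal_ofReal (by positivity), pi_rpow_half]

end Measure

section Mehler

/-- The Mehler kernel: the kernel, with respect to `γ₋₁`, of `e^{-t𝒜}` where `r = e^{-t}`. -/
def mehler (r : ℝ) (x y : E n) : ℝ :=
  (π ^ n)⁻¹ * (r / √(1 - r ^ 2)) ^ n *
    exp (-(‖x‖ ^ 2 + ‖y‖ ^ 2 - 2 * r * inner ℝ x y) / (1 - r ^ 2))

theorem mehler_comm (r : ℝ) (x y : E n) : mehler r x y = mehler r y x := by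
  rw [mehler, mehler, real_inner_comm, add_comm (‖x‖ ^ 2)]

theorem mehler_nonneg {r : ℝ} (hr : 0 ≤ r) (x y : E n) : 0 ≤ mehler r x y := by
  unfold mehler; positivity

theorem measurable_mehler :
    Measurable fun z : ℝ × E n × E n => mehler z.1 z.2.1 z.2.2 := by
  unfold mehler; fun_prop

theorem norm_sub_smul_sq {V : Type*} [NormedAddCommGroup V] [InnerProductSpace ℝ V] (c : ℝ)
    (x y : V) : ‖y - c • x‖ ^ 2 = ‖y‖ ^ 2 - 2 * c * inner ℝ x y + c ^ 2 * ‖x‖ ^ 2 := by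
  rw [norm_sub_sq_real, inner_smul_right, norm_smul, mul_pow, real_inner_comm x y, norm_eq_abs,
    sq_abs]
  ring

theorem exp_sq_mul_mehler_mul_exp {r a d : ℝ} (hr : 0 < 1 - r ^ 2) (hd0 : 0 < d)
    (hd : d = r ^ 2 + a * (1 - r ^ 2)) (x y : E n) :
    √π ^ n * exp (‖y‖ ^ 2) * (mehler r x y * exp (-a * ‖y‖ ^ 2)) =
      √π ^ n * ((π ^ n)⁻¹ * (r / √(1 - r ^ 2)) ^ n) * exp (-a / d * ‖x‖ ^ 2) *
        exp (-(d / (1 - r ^ 2)) * ‖y - (r / d) • x‖ ^ 2) := by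
  have complete_square :
      exp (‖y‖ ^ 2) * (exp (-(‖x‖ ^ 2 + ‖y‖ ^ 2 - 2 * r * inner ℝ x y) / (1 - r ^ 2)) *
        exp (-a * ‖y‖ ^ 2)) =
      exp (-a / d * ‖x‖ ^ 2) * exp (-(d / (1 - r ^ 2)) * ‖y - (r / d) • x‖ ^ 2) := by
    rw [← exp_add, ← exp_add, ← exp_add, norm_sub_smul_sq]
    congr 1
    field_simp
    rw [hd]
    ring
  rw [mehler]
  linear_combination (√π ^ n * ((π ^ n)⁻¹ * (r / √(1 - r ^ 2)) ^ n)) * complete_square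

theorem sqrt_pi_pow_mul_mehler_const {r d : ℝ} (hr : 0 < 1 - r ^ 2) (hd : 0 < d) (n : ℕ) :
    √π ^ n * ((π ^ n)⁻¹ * (r / √(1 - r ^ 2)) ^ n) * √(π / (d / (1 - r ^ 2))) ^ n =
      (r / √d) ^ n := by
  rw [← inv_pow, ← mul_pow, ← mul_pow, ← mul_pow, div_div_eq_mul_div, sqrt_div (by positivity),
    sqrt_mul pi_pos.le]
  have := sqrt_pos.2 hr
  have hpi : √π ^ 2 = π := sq_sqrt pi_pos.le
  congr 1
  field_simp
  rw [hpi]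

theorem lintegral_mehler_mul_gaussian {r a : ℝ} (hr0 : 0 < r) (hr1 : r < 1) (ha0 : 0 ≤ a)
    (x : E n) :
    ∫⁻ y, ENNReal.ofReal (mehler r x y) * ENNReal.ofReal (exp (-a * ‖y‖ ^ 2)) ∂(gammaInv n) =
      ENNReal.ofReal ((r / √(r ^ 2 + a * (1 - r ^ 2))) ^ n *
        exp (-a / (r ^ 2 + a * (1 - r ^ 2)) * ‖x‖ ^ 2)) := by
  have hr2 : 0 < 1 - r ^ 2 := by nlinarith
  set d := r ^ 2 + a * (1 - r ^ 2) with hd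
  have hd0 : 0 < d := by positivity
  have hpoint : ∀ y : E n, ENNReal.ofReal (√π ^ n * exp (‖y‖ ^ 2)) *
      (ENNReal.ofReal (mehler r x y) * ENNReal.ofReal (exp (-a * ‖y‖ ^ 2))) =
      ENNReal.ofReal (√π ^ n * ((π ^ n)⁻¹ * (r / √(1 - r ^ 2)) ^ n) * exp (-a / d * ‖x‖ ^ 2)) *
        ENNReal.ofReal (exp (-(d / (1 - r ^ 2)) * ‖y - (r / d) • x‖ ^ 2)) := fun y => by
    rw [← ENNReal.ofReal_mul (mehler_nonneg hr0.le _ _), ← ENNReal.ofReal_mul (by positivity),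
      ← ENNReal.ofReal_mul (by positivity), exp_sq_mul_mehler_mul_exp hr2 hd0 hd]
  rw [lintegral_gammaInv]
  simp_rw [hpoint]
  rw [lintegral_const_mul _ (by fun_prop), lintegral_exp_neg_mul_sq_norm_sub (by positivity),
    finrank_euclideanSpace_fin, ← ENNReal.ofReal_mul (by positivity),
    ← sqrt_pi_pow_mul_mehler_const hr2 hd0 n]
  congr 1
  ring

/-- The kernel of `e^{-t𝒜}` with respect to `γ₋₁`, with values in `[0, ∞]`. -/
def semigroupKernel (t : ℝ) (x y : E n) : ℝ≥0∞ := ENNReal.ofReal (mehler (exp (-t)) x y)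

theorem semigroupKernel_comm (t : ℝ) (x y : E n) :
    semigroupKernel t x y = semigroupKernel t y x := by
  rw [semigroupKernel, mehler_comm, semigroupKernel]

theorem measurable_semigroupKernel {α : Type*} [MeasurableSpace α] {f : α → ℝ} {g h : α → E n}
    (hf : Measurable f) (hg : Measurable g) (hh : Measurable h) :
    Measurable fun a => semigroupKernel (f a) (g a) (h a) :=
  (measurable_mehler.comp (hf.neg.exp.prodMk (hg.prodMk hh))).ennreal_ofReal

theorem lintegral_semigroupKernel {t : ℝ} (ht : 0 < t) (x : E n) :
    ∫⁻ y, semigroupKernel t x y ∂(gammaInv n) = 1 := by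
  have h := lintegral_mehler_mul_gaussian (exp_pos (-t))
    (exp_lt_one_iff.2 (neg_lt_zero.2 ht)) le_rfl x
  simpa [semigroupKernel, sqrt_sq (exp_pos (-t)).le] using h

theorem lintegralOp_semigroupKernel_gaussian_le {t a : ℝ} (ht : 0 < t) (ha0 : 0 < a) (ha1 : a ≤ 1)
    (x : E n) :
    lintegralOp (gammaInv n) (semigroupKernel t) (fun y => ENNReal.ofReal (exp (-a * ‖y‖ ^ 2))) x ≤
      ENNReal.ofReal (√a ^ n)⁻¹ * ENNReal.ofReal (exp (-n * t)) *
        ENNReal.ofReal (exp (-a * ‖x‖ ^ 2)) := by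
  have hr1 : exp (-t) < 1 := exp_lt_one_iff.2 (neg_lt_zero.2 ht)
  refine (lintegral_mehler_mul_gaussian (exp_pos (-t)) hr1 ha0.le x).trans_le ?_
  rw [← ENNReal.ofReal_mul (by positivity), ← ENNReal.ofReal_mul (by positivity)]
  apply ENNReal.ofReal_le_ofReal
  have hexp : exp (-n * t) = exp (-t) ^ n := by rw [← exp_nat_mul]; congr 1; ring
  rw [hexp]
  have hr0 : 0 < exp (-t) := exp_pos _
  generalize exp (-t) = r at hr0 hr1
  have hr2 : 0 < 1 - r ^ 2 := by nlinarith
  have hlower : a ≤ r ^ 2 + a * (1 - r ^ 2) := by nlinarith [sq_nonneg r]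
  have hupper : r ^ 2 + a * (1 - r ^ 2) ≤ 1 := by nlinarith [sq_nonneg r]
  have := sqrt_pos.2 ha0
  rw [← inv_pow, ← mul_pow, inv_mul_eq_div]
  gcongr
  rw [neg_div, neg_le_neg_iff]
  exact le_div_self ha0.le (by positivity) hupper

end Mehler

section NegativePower

/-- The measure `t^(β-1) / Γ(β) dt` on `(0, ∞)`, against which `e^{-ct}` integrates to `c^{-β}`. -/
def riemannLiouville (β : ℝ) : Measure ℝ :=
  (volume.restrict (Ioi 0)).withDensity fun t => ENNReal.ofReal (t ^ (β - 1) / Gamma β)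

instance (β : ℝ) : SigmaFinite (riemannLiouville β) :=
  SigmaFinite.withDensity_of_ne_top (by simp)

theorem lintegral_riemannLiouville (β : ℝ) (f : ℝ → ℝ≥0∞) :
    ∫⁻ t, f t ∂(riemannLiouville β) =
      ∫⁻ t in Ioi 0, ENNReal.ofReal (t ^ (β - 1) / Gamma β) * f t :=
  lintegral_withDensity_eq_lintegral_mul_non_measurable _ (by fun_prop) (by simp) _

theorem ae_pos_riemannLiouville (β : ℝ) : ∀ᵐ t ∂(riemannLiouville β), 0 < t :=
  (withDensity_absolutelyContinuous _ _).ae_le (ae_restrict_mem measurableSet_Ioi)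

theorem integral_exp_riemannLiouville {β c : ℝ} (hβ : 0 < β) (hc : 0 < c) :
    ∫ t, exp (-c * t) ∂(riemannLiouville β) = (c ^ β)⁻¹ := by
  have := Gamma_pos_of_pos hβ
  rw [riemannLiouville, integral_withDensity_eq_integral_toReal_smul (by fun_prop) (by simp)]
  have hdensity : ∀ t ∈ Ioi (0 : ℝ),
      (ENNReal.ofReal (t ^ (β - 1) / Gamma β)).toReal • exp (-c * t) =
        (Gamma β)⁻¹ * (t ^ (β - 1) * exp (-(c * t))) := fun t (ht : 0 < t) => by
    rw [ENNReal.toReal_ofReal (by positivity), smul_eq_mul, neg_mul]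
    ring
  rw [setIntegral_congr_fun measurableSet_Ioi hdensity, integral_const_mul,
    integral_rpow_mul_exp_neg_mul_Ioi hβ hc, one_div, inv_rpow hc.le]
  field_simp

theorem lintegral_exp_riemannLiouville {β c : ℝ} (hβ : 0 < β) (hc : 0 < c) :
    ∫⁻ t, ENNReal.ofReal (exp (-c * t)) ∂(riemannLiouville β) = ENNReal.ofReal (c ^ β)⁻¹ := by
  have hint := integral_exp_riemannLiouville hβ hc
  rw [← hint, ofReal_integral_eq_lintegral_ofReal (.of_integral_ne_zero (by rw [hint]; positivity))
    (.of_forall fun _ => (exp_pos _).le)]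

theorem riemannLiouville_Iic_one_lt_top {β : ℝ} (hβ : 0 < β) :
    riemannLiouville β (Iic 1) < ∞ := by
  have hsub : Iic 1 ⊆ {t : ℝ | ENNReal.ofReal (exp (-1)) ≤ ENNReal.ofReal (exp (-1 * t))} :=
    fun t (ht : t ≤ 1) => ENNReal.ofReal_le_ofReal (exp_le_exp.2 (by linarith))
  calc riemannLiouville β (Iic 1)
      ≤ (∫⁻ t, ENNReal.ofReal (exp (-1 * t)) ∂(riemannLiouville β)) /
          ENNReal.ofReal (exp (-1)) :=
        (measure_mono hsub).trans
          (meas_ge_le_lintegral_div (by fun_prop) (by simp [exp_pos]) ENNReal.ofReal_ne_top)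
    _ < ∞ := by
        rw [lintegral_exp_riemannLiouville hβ one_pos]
        exact ENNReal.div_lt_top ENNReal.ofReal_ne_top (by simp [exp_pos])

/-- The kernel of `𝒜^{-β} = Γ(β)⁻¹ ∫₀^∞ t^(β-1) e^{-t𝒜} dt` with respect to `γ₋₁`. -/
def negPowKernel (β : ℝ) (x y : E n) : ℝ≥0∞ :=
  ∫⁻ t, semigroupKernel t x y ∂(riemannLiouville β)

theorem negPowKernel_comm (β : ℝ) (x y : E n) : negPowKernel β x y = negPowKernel β y x := by
  simp only [negPowKernel, semigroupKernel_comm _ x y]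

theorem measurable_negPowKernel (β : ℝ) :
    Measurable (Function.uncurry (negPowKernel (n := n) β)) :=
  Measurable.lintegral_prod_right (f := fun (z : E n × E n) t => semigroupKernel t z.1 z.2)
    (measurable_semigroupKernel (by fun_prop) (by fun_prop) (by fun_prop))

theorem toReal_negPowKernel (β : ℝ) (x y : E n) :
    (negPowKernel β x y).toReal = ∫ t, mehler (exp (-t)) x y ∂(riemannLiouville β) :=
  (integral_eq_lintegral_of_nonneg_ae (.of_forall fun _ => mehler_nonneg (exp_pos _).le _ _)
    (measurable_mehler.comp (f := fun t : ℝ => (exp (-t), x, y))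
      (by fun_prop)).aestronglyMeasurable).symm

theorem lintegralOp_negPowKernel (β : ℝ) {f : E n → ℝ≥0∞} (hf : Measurable f) (x : E n) :
    lintegralOp (gammaInv n) (negPowKernel β) f x =
      ∫⁻ t, lintegralOp (gammaInv n) (semigroupKernel t) f x ∂(riemannLiouville β) := by
  calc lintegralOp (gammaInv n) (negPowKernel β) f x
      = ∫⁻ y, ∫⁻ t, semigroupKernel t x y * f y ∂(riemannLiouville β) ∂(gammaInv n) :=
        lintegral_congr fun y => (lintegral_mul_const _
          (measurable_semigroupKernel measurable_id measurable_const measurable_const)).symm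
    _ = _ := lintegral_lintegral_swap
          ((measurable_semigroupKernel measurable_snd measurable_const measurable_fst).mul
            (hf.comp measurable_fst)).aemeasurable

theorem lintegralOp_negPowKernel_gaussian_le {β a : ℝ} (hβ : 0 < β) (hn : 0 < n) (ha0 : 0 < a)
    (ha1 : a ≤ 1) (x : E n) :
    lintegralOp (gammaInv n) (negPowKernel β) (fun y => ENNReal.ofReal (exp (-a * ‖y‖ ^ 2))) x ≤
      ENNReal.ofReal (√a ^ n)⁻¹ * ENNReal.ofReal ((n : ℝ) ^ β)⁻¹ *
        ENNReal.ofReal (exp (-a * ‖x‖ ^ 2)) := by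
  rw [lintegralOp_negPowKernel β (by fun_prop),
    ← lintegral_exp_riemannLiouville hβ (by exact_mod_cast hn),
    ← lintegral_const_mul _ (by fun_prop), ← lintegral_mul_const _ (by fun_prop)]
  refine lintegral_mono_ae ?_
  filter_upwards [ae_pos_riemannLiouville β] with t ht
  exact lintegralOp_semigroupKernel_gaussian_le ht ha0 ha1 x

theorem exists_lintegralOp_negPowKernel_gaussian_rpow_le (hn : 0 < n) {β : ℝ} (hβ : 0 < β)
    {b s : ℝ} (hb : 0 < b) (hs : 0 < s) (hbs : b * s ≤ 1) :
    ∃ C : ℝ≥0, ∀ x : E n,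
      lintegralOp (gammaInv n) (negPowKernel β)
          (fun y => ENNReal.ofReal (exp (-b * ‖y‖ ^ 2)) ^ s) x ≤
        C * ENNReal.ofReal (exp (-b * ‖x‖ ^ 2)) ^ s := by
  have hpow : ∀ x : E n, ENNReal.ofReal (exp (-b * ‖x‖ ^ 2)) ^ s =
      ENNReal.ofReal (exp (-(b * s) * ‖x‖ ^ 2)) := fun x => by
    rw [ENNReal.ofReal_rpow_of_nonneg (exp_pos _).le hs.le, ← exp_mul]
    ring_nf
  refine ⟨(√(b * s) ^ n)⁻¹.toNNReal * ((n : ℝ) ^ β)⁻¹.toNNReal, fun x => ?_⟩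
  simp_rw [hpow]
  rw [ENNReal.coe_mul]
  exact lintegralOp_negPowKernel_gaussian_le hβ hn (by positivity) hbs x

theorem exists_hasStrongType_negPowKernel (hn : 0 < n) {β : ℝ} (hβ : 0 < β) {p : ℝ≥0∞}
    (hp1 : 1 < p) (hp : p ≠ ∞) :
    ∃ C : ℝ≥0, HasStrongType (gammaInv n) (gammaInv n) (negPowKernel β) p C := by
  have hpq := Real.HolderConjugate.conjExponent
    ((ENNReal.toReal_lt_toReal ENNReal.one_ne_top hp).2 hp1)
  set q := (p.toReal).conjExponent
  have hp0 := hpq.pos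
  have hq0 := hpq.symm.pos
  -- Schur's test with the weight `exp (-b‖x‖²)`; its powers `p` and `q` are controlled by the
  -- Gaussian bound for the kernel because `b = 1 / (p + q)` makes both `b p` and `b q` at most `1`.
  have hb0 : 0 < (p.toReal + q)⁻¹ := by positivity
  obtain ⟨A, hA⟩ := exists_lintegralOp_negPowKernel_gaussian_rpow_le hn hβ hb0 hp0
    (inv_mul_le_one_of_le₀ (by linarith) (by positivity))
  obtain ⟨B, hB⟩ := exists_lintegralOp_negPowKernel_gaussian_rpow_le hn hβ hb0 hq0
    (inv_mul_le_one_of_le₀ (by linarith) (by positivity))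
  have hswap : Function.swap (negPowKernel (n := n) β) = negPowKernel β :=
    funext₂ fun x y => negPowKernel_comm β y x
  refine ⟨max A B, hasStrongType_of_lintegral_rpow_le (zero_lt_one.trans hp1).ne' hp
    fun f hf => lintegral_lintegralOp_rpow_le_of_schur (measurable_negPowKernel β) hpq
      (u := fun x => ENNReal.ofReal (exp (-(p.toReal + q)⁻¹ * ‖x‖ ^ 2)))
      (w := fun x => ENNReal.ofReal (exp (-(p.toReal + q)⁻¹ * ‖x‖ ^ 2)))
      (by fun_prop) (by fun_prop) (fun _ => by simp [exp_pos]) (fun _ => ENNReal.ofReal_ne_top)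
      (fun x => (hB x).trans ?_) (fun y => ?_) hf⟩
  · gcongr
    exact le_max_right A B
  · rw [hswap]
    refine (hA y).trans ?_
    gcongr
    exact le_max_left A B

end NegativePower

section Dilation

variable {V : Type*} [NormedAddCommGroup V] [NormedSpace ℝ V]

/-- The potential `∫ e^{-αt} G(e^{-t} x) dt` along the orbit of `x` under dilations; on every ray it
is a multiple of `‖x‖ ^ (-α)`. -/
def dilationPotential (α : ℝ) (G : V → ℝ≥0∞) (x : V) : ℝ≥0∞ :=
  ∫⁻ t : ℝ, ENNReal.ofReal (exp (-α * t)) * G (exp (-t) • x)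

theorem dilationPotential_smul (α : ℝ) (G : V → ℝ≥0∞) {ρ : ℝ} (hρ : 0 < ρ) (x : V) :
    dilationPotential α G (ρ • x) = ENNReal.ofReal (ρ ^ (-α)) * dilationPotential α G x := by
  rw [dilationPotential, ← lintegral_add_right_eq_self _ (log ρ), dilationPotential,
    ← lintegral_const_mul' _ _ ENNReal.ofReal_ne_top]
  refine lintegral_congr fun t => ?_
  have hexp : exp (-(t + log ρ)) * ρ = exp (-t) := by
    rw [neg_add, exp_add, exp_neg (log ρ), exp_log hρ, inv_mul_cancel_right₀ hρ.ne']
  rw [smul_smul, hexp, ← mul_assoc, ← ENNReal.ofReal_mul (by positivity), rpow_def_of_pos hρ,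
    ← exp_add]
  ring_nf

theorem dilationPotential_eq_setLIntegral (α : ℝ) (G : V → ℝ≥0∞) (x : V) :
    dilationPotential α G x = ∫⁻ u in Ioi (0 : ℝ), ENNReal.ofReal (u ^ (α - 1)) * G (u • x) := by
  have hrange : (fun t : ℝ => exp (-t)) '' univ = Ioi 0 := by
    rw [image_univ, ← range_exp]
    exact (Equiv.neg ℝ).surjective.range_comp exp
  have hderiv : ∀ t ∈ (univ : Set ℝ),
      HasDerivWithinAt (fun t => exp (-t)) (exp (-t) * -1) univ t := fun t _ =>
    (hasDerivAt_neg t).exp.hasDerivWithinAt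
  rw [← hrange, lintegral_image_eq_lintegral_abs_deriv_mul MeasurableSet.univ hderiv
    (exp_injective.comp neg_injective).injOn, setLIntegral_univ]
  refine lintegral_congr fun t => ?_
  rw [← mul_assoc, ← ENNReal.ofReal_mul (abs_nonneg _), mul_neg_one, abs_neg, abs_exp, ← exp_mul,
    ← exp_add]
  ring_nf

variable [MeasurableSpace V] [BorelSpace V]

theorem lintegralOp_dilationPotential (α : ℝ) {Y : Type*} [MeasurableSpace Y] {ν : Measure Y}
    [SFinite ν] {J : V → Y → ℝ≥0∞} (hJ : Measurable (Function.uncurry J)) {f : Y → ℝ≥0∞}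
    (hf : Measurable f) (x : V) :
    lintegralOp ν (fun x y => dilationPotential α (J · y) x) f x =
      dilationPotential α (lintegralOp ν J f) x := by
  have hJx : Measurable fun z : Y × ℝ => J (exp (-z.2) • x) z.1 :=
    hJ.comp (f := fun z : Y × ℝ => (exp (-z.2) • x, z.1)) (by fun_prop)
  have hJt : ∀ y, Measurable fun t : ℝ => J (exp (-t) • x) y := fun y =>
    hJx.comp (measurable_prodMk_left (x := y))
  calc lintegralOp ν (fun x y => dilationPotential α (J · y) x) f x
      = ∫⁻ y, (∫⁻ t : ℝ, ENNReal.ofReal (exp (-α * t)) * (J (exp (-t) • x) y * f y)) ∂ν := by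
        refine lintegral_congr fun y => ?_
        have := hJt y
        simp_rw [← mul_assoc]
        exact (lintegral_mul_const _ (by fun_prop)).symm
    _ = ∫⁻ t : ℝ, ∫⁻ y, ENNReal.ofReal (exp (-α * t)) * (J (exp (-t) • x) y * f y) ∂ν :=
        lintegral_lintegral_swap (by fun_prop)
    _ = _ := lintegral_congr fun t => lintegral_const_mul' _ _ ENNReal.ofReal_ne_top

variable [FiniteDimensional ℝ V]

theorem measurable_dilationPotential (α : ℝ) {G : V → ℝ≥0∞} (hG : Measurable G) :
    Measurable (dilationPotential α G) :=
  Measurable.lintegral_prod_right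
    (f := fun (x : V) (t : ℝ) => ENNReal.ofReal (exp (-α * t)) * G (exp (-t) • x))
    (by fun_prop)

variable [Nontrivial V]

theorem lintegral_eq_lintegral_toSphere (μ : Measure V) [μ.IsAddHaarMeasure] {f : V → ℝ≥0∞}
    (hf : Measurable f) :
    ∫⁻ x, f x ∂μ = ∫⁻ ω : Metric.sphere (0 : V) 1, (∫⁻ ρ in Ioi (0 : ℝ),
      ENNReal.ofReal (ρ ^ (Module.finrank ℝ V - 1)) * f (ρ • (ω : V))) ∂μ.toSphere := by
  calc ∫⁻ x, f x ∂μ = ∫⁻ x : ({(0)}ᶜ : Set V), f x ∂(Measure.comap Subtype.val μ) := by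
        rw [lintegral_subtype_comap (measurableSet_singleton _).compl, restrict_compl_singleton]
    _ = ∫⁻ x : ({(0)}ᶜ : Set V), (fun z : Metric.sphere (0 : V) 1 × Ioi (0 : ℝ) =>
          f ((z.2 : ℝ) • (z.1 : V))) (homeomorphUnitSphereProd V x)
            ∂(Measure.comap Subtype.val μ) := by
        refine lintegral_congr fun x => ?_
        have hx : ‖(x : V)‖ ≠ 0 := norm_ne_zero_iff.2 x.2
        simp [smul_smul, hx]
    _ = ∫⁻ z, f ((z.2 : ℝ) • (z.1 : V))
          ∂(μ.toSphere.prod (Measure.volumeIoiPow (Module.finrank ℝ V - 1))) :=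
        μ.measurePreserving_homeomorphUnitSphereProd.lintegral_comp
          (f := fun z : Metric.sphere (0 : V) 1 × Ioi (0 : ℝ) => f ((z.2 : ℝ) • (z.1 : V)))
          (by fun_prop)
    _ = _ := by
        rw [lintegral_prod _ (by fun_prop)]
        refine lintegral_congr fun ω => ?_
        rw [Measure.volumeIoiPow, lintegral_withDensity_eq_lintegral_mul _ (by fun_prop)
          (by fun_prop)]
        exact lintegral_subtype_comap (μ := volume) measurableSet_Ioi
          fun ρ : ℝ => ENNReal.ofReal (ρ ^ (Module.finrank ℝ V - 1)) * f (ρ • (ω : V))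

theorem lintegral_toSphere_dilationPotential (μ : Measure V) [μ.IsAddHaarMeasure] (α : ℝ)
    {G : V → ℝ≥0∞} (hG : Measurable G) :
    ∫⁻ ω : Metric.sphere (0 : V) 1, dilationPotential α G ω ∂μ.toSphere =
      ∫⁻ x, ENNReal.ofReal (‖x‖ ^ (α - Module.finrank ℝ V)) * G x ∂μ := by
  rw [lintegral_eq_lintegral_toSphere μ (by fun_prop)]
  refine lintegral_congr fun ω => ?_
  rw [dilationPotential_eq_setLIntegral]
  refine setLIntegral_congr_fun measurableSet_Ioi fun ρ (hρ : 0 < ρ) => ?_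
  have hd : 1 ≤ Module.finrank ℝ V := Module.finrank_pos
  rw [norm_smul_of_nonneg hρ.le, norm_eq_of_mem_sphere, mul_one, ← mul_assoc,
    ← ENNReal.ofReal_mul (by positivity), ← rpow_natCast, ← rpow_add hρ, Nat.cast_sub hd,
    Nat.cast_one]
  ring_nf

end Dilation

section Rays

theorem setLIntegral_deriv_le {S : Set ℝ} (hS : MeasurableSet S) {h h' : ℝ → ℝ}
    (hderiv : ∀ ρ ∈ S, HasDerivWithinAt h (h' ρ) S ρ) (hmono : MonotoneOn h S)
    (hnonneg : ∀ ρ ∈ S, 0 ≤ h ρ) {a : ℝ≥0∞} (hle : ∀ ρ ∈ S, ENNReal.ofReal (h ρ) ≤ a) :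
    ∫⁻ ρ in S, ENNReal.ofReal (h' ρ) ≤ a := by
  rcases eq_or_ne a ∞ with rfl | ha
  · exact le_top
  have hsub : h '' S ⊆ Icc 0 a.toReal := by
    rintro _ ⟨ρ, hρ, rfl⟩
    exact ⟨hnonneg ρ hρ, (ENNReal.ofReal_le_iff_le_toReal ha).1 (hle ρ hρ)⟩
  calc ∫⁻ ρ in S, ENNReal.ofReal (h' ρ) = volume (h '' S) :=
        lintegral_deriv_eq_volume_image_of_monotoneOn hS hderiv hmono
    _ ≤ volume (Icc 0 a.toReal) := measure_mono hsub
    _ = a := by rw [volume_Icc, sub_zero, ENNReal.ofReal_toReal ha]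

theorem setLIntegral_rpow_mul_exp_sq_le {α : ℝ} (hα : 1 / 2 ≤ α) (a : ℝ≥0∞) :
    ∫⁻ ρ in {ρ : ℝ | 0 < ρ ∧ ENNReal.ofReal (ρ ^ α * exp (ρ ^ 2)) < a},
      ENNReal.ofReal (ρ ^ (α - 1 / 2) * exp (ρ ^ 2)) ≤ 2 * a := by
  set S := {ρ : ℝ | 0 < ρ ∧ ENNReal.ofReal (ρ ^ α * exp (ρ ^ 2)) < a}
  have hS : MeasurableSet S :=
    measurableSet_Ioi.inter (measurableSet_lt
      (f := fun ρ : ℝ => ENNReal.ofReal (ρ ^ α * exp (ρ ^ 2))) (by fun_prop) measurable_const)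
  have hderiv : ∀ ρ ∈ S, HasDerivWithinAt (fun ρ => ρ ^ α * exp (ρ ^ 2))
      (ρ ^ (α - 1) * exp (ρ ^ 2) * (α + 2 * ρ ^ 2)) S ρ := fun ρ hρ => by
    have hmul := (hasDerivAt_rpow_const (p := α) (Or.inl hρ.1.ne')).mul (hasDerivAt_pow 2 ρ).exp
    refine (hmul.congr_deriv ?_).hasDerivWithinAt
    rw [show ρ ^ α = ρ ^ (α - 1) * ρ by rw [← rpow_add_one hρ.1.ne', sub_add_cancel]]
    simp only [Nat.cast_ofNat, Nat.add_one_sub_one, pow_one]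
    ring
  have hmono : MonotoneOn (fun ρ : ℝ => ρ ^ α * exp (ρ ^ 2)) S := fun ρ ⟨hρ, _⟩ σ _ hle => by
    have hσ : 0 < σ := hρ.trans_le hle
    dsimp only
    gcongr
  have hbound : ∀ ρ ∈ S, ENNReal.ofReal (ρ ^ (α - 1 / 2) * exp (ρ ^ 2)) ≤
      2 * ENNReal.ofReal (ρ ^ (α - 1) * exp (ρ ^ 2) * (α + 2 * ρ ^ 2)) := fun ρ ⟨hρ, _⟩ => by
    rw [← ENNReal.ofReal_ofNat 2, ← ENNReal.ofReal_mul (by norm_num)]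
    have hsqrt : √ρ ≤ 2 * (α + 2 * ρ ^ 2) := by
      nlinarith [sq_nonneg (√ρ - 1), sq_nonneg (ρ - 1 / 2), sq_sqrt hρ.le]
    have hsplit : ρ ^ (α - 1 / 2) = ρ ^ (α - 1) * √ρ := by
      rw [sqrt_eq_rpow, ← rpow_add hρ]
      ring_nf
    apply ENNReal.ofReal_le_ofReal
    calc ρ ^ (α - 1 / 2) * exp (ρ ^ 2) = ρ ^ (α - 1) * exp (ρ ^ 2) * √ρ := by rw [hsplit]; ring
      _ ≤ ρ ^ (α - 1) * exp (ρ ^ 2) * (2 * (α + 2 * ρ ^ 2)) := by gcongr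
      _ = _ := by ring
  refine (setLIntegral_mono' hS hbound).trans ?_
  rw [lintegral_const_mul' _ _ ENNReal.ofNat_ne_top]
  gcongr
  exact setLIntegral_deriv_le hS hderiv hmono (fun ρ ⟨hρ, _⟩ => by positivity)
    fun ρ hρ => hρ.2.le

theorem lt_exp_mul_dilationPotential_iff {V : Type*} [NormedAddCommGroup V] [NormedSpace ℝ V]
    (α : ℝ) (G : V → ℝ≥0∞) {s : ℝ≥0} (hs : s ≠ 0) {ω : V} (hω : ‖ω‖ = 1) {ρ : ℝ} (hρ : 0 < ρ) :
    s < ENNReal.ofReal (exp (-‖ρ • ω‖ ^ 2)) * dilationPotential α G (ρ • ω) ↔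
      ENNReal.ofReal (ρ ^ α * exp (ρ ^ 2)) < dilationPotential α G ω / s := by
  have hc : 0 < ρ ^ α * exp (ρ ^ 2) := by positivity
  have hinv : exp (-ρ ^ 2) * ρ ^ (-α) = (ρ ^ α * exp (ρ ^ 2))⁻¹ := by
    rw [exp_neg, rpow_neg hρ.le, mul_inv, mul_comm]
  rw [dilationPotential_smul α G hρ, norm_smul_of_nonneg hρ.le, hω, mul_one, ← mul_assoc,
    ← ENNReal.ofReal_mul (exp_pos _).le, hinv, ENNReal.ofReal_inv_of_pos hc, mul_comm,
    ← div_eq_mul_inv, ENNReal.lt_div_iff_mul_lt (Or.inl (by simpa using hc)) (Or.inl (by simp)),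
    ENNReal.lt_div_iff_mul_lt (Or.inl (by simpa using hs)) (Or.inl (by simp)), mul_comm]

theorem gammaInv_eq_lintegral_toSphere (hn : 0 < n) {A : Set (E n)} (hA : MeasurableSet A) :
    gammaInv n A = ∫⁻ ω : Metric.sphere (0 : E n) 1, ENNReal.ofReal (√π ^ n) *
      (∫⁻ ρ in {ρ : ℝ | 0 < ρ ∧ ρ • (ω : E n) ∈ A},
        ENNReal.ofReal (ρ ^ ((n : ℝ) - 1) * exp (ρ ^ 2))) ∂((volume : Measure (E n)).toSphere) := by
  have : Nonempty (Fin n) := ⟨⟨0, hn⟩⟩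
  have : Measurable (A.indicator (1 : E n → ℝ≥0∞)) := measurable_one.indicator hA
  rw [← lintegral_indicator_one hA, lintegral_gammaInv, lintegral_eq_lintegral_toSphere volume
    (by fun_prop)]
  refine lintegral_congr fun ω => ?_
  have hS : MeasurableSet {ρ : ℝ | 0 < ρ ∧ ρ • (ω : E n) ∈ A} :=
    measurableSet_Ioi.inter (measurableSet_preimage (by fun_prop) hA)
  rw [← lintegral_const_mul' _ _ ENNReal.ofReal_ne_top, ← lintegral_indicator hS,
    ← lintegral_indicator measurableSet_Ioi]
  refine lintegral_congr fun ρ => ?_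
  by_cases hρ : 0 < ρ
  · by_cases hmem : ρ • (ω : E n) ∈ A
    · have hpow : ρ ^ (Module.finrank ℝ (E n) - 1) = ρ ^ ((n : ℝ) - 1) := by
        rw [finrank_euclideanSpace_fin, ← rpow_natCast, Nat.cast_sub hn, Nat.cast_one]
      have hmem' : ρ ∈ {ρ : ℝ | 0 < ρ ∧ ρ • (ω : E n) ∈ A} := ⟨hρ, hmem⟩
      rw [indicator_of_mem (mem_Ioi.2 hρ), indicator_of_mem hmem, indicator_of_mem hmem', hpow,
        norm_smul_of_nonneg hρ.le, norm_eq_of_mem_sphere]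
      simp only [Pi.one_apply, mul_one]
      rw [← ENNReal.ofReal_mul (by positivity), ← ENNReal.ofReal_mul (by positivity),
        mul_left_comm]
    · simp [indicator, hmem]
  · simp [indicator, hρ]

theorem gammaInv_dilationPotential_le (hn : 0 < n) {G : E n → ℝ≥0∞} (hG : Measurable G) {s : ℝ≥0}
    (hs : s ≠ 0) :
    gammaInv n {x | s < ENNReal.ofReal (exp (-‖x‖ ^ 2)) *
        dilationPotential ((n : ℝ) - 1 / 2) G x} ≤
      ENNReal.ofReal (√π ^ n) * 2 / s * ∫⁻ z, ENNReal.ofReal (‖z‖ ^ (-(1 / 2) : ℝ)) * G z := by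
  have : Nonempty (Fin n) := ⟨⟨0, hn⟩⟩
  have hn1 : (1 : ℝ) ≤ n := by exact_mod_cast hn
  have hray : ∀ ω : Metric.sphere (0 : E n) 1,
      ∫⁻ ρ in {ρ : ℝ | 0 < ρ ∧ s < ENNReal.ofReal (exp (-‖ρ • (ω : E n)‖ ^ 2)) *
          dilationPotential ((n : ℝ) - 1 / 2) G (ρ • (ω : E n))},
        ENNReal.ofReal (ρ ^ ((n : ℝ) - 1) * exp (ρ ^ 2)) ≤
      2 * (dilationPotential ((n : ℝ) - 1 / 2) G ω / s) := fun ω => by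
    have h := setLIntegral_rpow_mul_exp_sq_le (α := (n : ℝ) - 1 / 2) (by linarith)
      (dilationPotential ((n : ℝ) - 1 / 2) G ω / s)
    rw [sub_sub, add_halves] at h
    refine le_trans (lintegral_mono_set ?_) h
    rintro ρ ⟨hρ, hlt⟩
    exact ⟨hρ, (lt_exp_mul_dilationPotential_iff _ G hs (norm_eq_of_mem_sphere ω) hρ).1 hlt⟩
  have hpolar := lintegral_toSphere_dilationPotential (volume : Measure (E n)) ((n : ℝ) - 1 / 2) hG
  rw [finrank_euclideanSpace_fin, sub_sub_cancel_left] at hpolar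
  have hD := measurable_dilationPotential ((n : ℝ) - 1 / 2) hG
  rw [gammaInv_eq_lintegral_toSphere hn (measurableSet_lt measurable_const (by fun_prop)),
    ← hpolar, ← lintegral_const_mul _ (by fun_prop)]
  refine lintegral_mono fun ω => ?_
  calc _ ≤ ENNReal.ofReal (√π ^ n) * (2 * (dilationPotential ((n : ℝ) - 1 / 2) G ω / s)) := by
        gcongr
        exact hray ω
    _ = _ := by simp only [div_eq_mul_inv]; ring

theorem hasWeakTypeOne_dilationPotential (hn : 0 < n) {Y : Type*} [MeasurableSpace Y]
    {ν : Measure Y} [SFinite ν] {J : E n → Y → ℝ≥0∞} (hJ : Measurable (Function.uncurry J))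
    {A : ℝ≥0} (hA : ∀ y, ∫⁻ z, ENNReal.ofReal (‖z‖ ^ (-(1 / 2) : ℝ)) * J z y ≤ A) :
    HasWeakTypeOne (gammaInv n) ν (fun x y => ENNReal.ofReal (exp (-‖x‖ ^ 2)) *
      dilationPotential ((n : ℝ) - 1 / 2) (J · y) x) ((√π ^ n).toNNReal * 2 * A) := by
  intro f hf s hs
  have hnorm : ∫⁻ z, ENNReal.ofReal (‖z‖ ^ (-(1 / 2) : ℝ)) * lintegralOp ν J f z ≤
      A * ∫⁻ y, f y ∂ν := by
    rw [lintegral_mul_lintegralOp hJ (by fun_prop) hf, ← lintegral_const_mul _ hf]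
    gcongr with y
    simpa only [lintegralOp, Function.swap, mul_comm] using hA y
  calc _ = gammaInv n {x | s < ENNReal.ofReal (exp (-‖x‖ ^ 2)) *
        dilationPotential ((n : ℝ) - 1 / 2) (lintegralOp ν J f) x} := by
        simp_rw [← lintegralOp_dilationPotential _ hJ hf]
        simp only [lintegralOp, mul_assoc, lintegral_const_mul' _ _ ENNReal.ofReal_ne_top]
    _ ≤ _ := gammaInv_dilationPotential_le hn (measurable_lintegralOp hJ hf) hs
    _ ≤ ENNReal.ofReal (√π ^ n) * 2 / s * (A * ∫⁻ y, f y ∂ν) := by gcongr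
    _ = _ := by
        rw [ENNReal.coe_mul, ENNReal.coe_mul, ENNReal.ofReal, ENNReal.coe_ofNat]
        simp only [div_eq_mul_inv]
        ring

end Rays

section SmallAndLargeTimes

theorem lintegral_norm_rpow_mul_le {V : Type*} [NormedAddCommGroup V] [MeasurableSpace V]
    [BorelSpace V] (μ : Measure V) {s : ℝ} (hs : s ≤ 0) {g : V → ℝ≥0∞}
    {M : ℝ≥0∞} (hM : ∀ z, g z ≤ M) :
    ∫⁻ z, ENNReal.ofReal (‖z‖ ^ s) * g z ∂μ ≤
      (∫⁻ z in Metric.ball 0 1, ENNReal.ofReal (‖z‖ ^ s) ∂μ) * M + ∫⁻ z, g z ∂μ := by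
  rw [← lintegral_add_compl _ Metric.isOpen_ball.measurableSet,
    ← lintegral_mul_const _ (by fun_prop)]
  refine add_le_add (lintegral_mono fun z => mul_le_mul_right (hM z) _) ?_
  refine (setLIntegral_mono' Metric.isOpen_ball.measurableSet.compl fun z hz => ?_).trans
    (setLIntegral_le_lintegral _ _)
  have hz1 : 1 ≤ ‖z‖ := by simpa using hz
  exact mul_le_of_le_one_left' (ENNReal.ofReal_le_one.2 (rpow_le_one_of_one_le_of_nonpos hz1 hs))

theorem setLIntegral_ball_norm_rpow_lt_top {V : Type*} [NormedAddCommGroup V] [NormedSpace ℝ V]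
    [FiniteDimensional ℝ V] [Nontrivial V] [MeasurableSpace V] [BorelSpace V] (μ : Measure V)
    [μ.IsAddHaarMeasure] {s : ℝ} (hs : -s < Module.finrank ℝ V) (R : ℝ) :
    ∫⁻ z in Metric.ball 0 R, ENNReal.ofReal (‖z‖ ^ s) ∂μ < ∞ := by
  have hloc : LocallyIntegrable (fun z : V => ‖z‖ ^ s) μ :=
    locallyIntegrable_of_norm_le_rpow (C := 1) Module.finrank_pos hs
      (.of_forall fun z => by simp [abs_of_nonneg (rpow_nonneg (norm_nonneg z) s)])
      (measurable_norm.pow_const s).aestronglyMeasurable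
  have hint := (hloc.integrableOn_isCompact (isCompact_closedBall 0 R)).mono_set
    Metric.ball_subset_closedBall
  exact (hasFiniteIntegral_iff_ofReal (.of_forall fun _ => by positivity)).1 hint.2

theorem exists_lintegral_norm_rpow_mul_gaussian_le (hn : 0 < n) {C : ℝ} (hC : 0 ≤ C) :
    ∃ A : ℝ≥0, ∀ y : E n, ∫⁻ z, ENNReal.ofReal (‖z‖ ^ (-(1 / 2) : ℝ)) *
      ENNReal.ofReal (C * exp (-‖z - y‖ ^ 2)) ≤ A := by
  have : Nonempty (Fin n) := ⟨⟨0, hn⟩⟩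
  have hn1 : (1 : ℝ) ≤ n := by exact_mod_cast hn
  have hball := setLIntegral_ball_norm_rpow_lt_top (V := E n) volume (s := -(1 / 2))
    (by rw [finrank_euclideanSpace_fin]; linarith) 1
  have hmass : ∀ y : E n, ∫⁻ z, ENNReal.ofReal (C * exp (-‖z - y‖ ^ 2)) =
      ENNReal.ofReal C * ENNReal.ofReal (√π ^ n) := fun y => by
    have h := lintegral_exp_neg_mul_sq_norm_sub one_pos y
    simp only [neg_mul, one_mul, div_one, finrank_euclideanSpace_fin] at h
    simp_rw [ENNReal.ofReal_mul hC]
    rw [lintegral_const_mul _ (by fun_prop), h]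
  lift (∫⁻ z in Metric.ball (0 : E n) 1, ENNReal.ofReal (‖z‖ ^ (-(1 / 2) : ℝ))) to ℝ≥0
    using hball.ne with I hI
  refine ⟨I * C.toNNReal + C.toNNReal * (√π ^ n).toNNReal, fun y => ?_⟩
  have h := lintegral_norm_rpow_mul_le volume (s := -(1 / 2)) (by norm_num)
    (g := fun z => ENNReal.ofReal (C * exp (-‖z - y‖ ^ 2)))
    (M := ENNReal.ofReal C) fun z => ENNReal.ofReal_le_ofReal
      (mul_le_of_le_one_right hC (exp_le_one_iff.2 (by simp)))
  rwa [hmass, ← hI] at h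

theorem mehler_le_of_le_half {r : ℝ} (hr0 : 0 ≤ r) (hr : r ≤ 1 / 2) (x y : E n) :
    mehler r x y ≤ r ^ n * exp (-‖x‖ ^ 2) * exp (-‖r • x - y‖ ^ 2) := by
  have hr2 : 0 < 1 - r ^ 2 := by nlinarith
  have hsqrt : 1 / 2 ≤ √(1 - r ^ 2) := le_sqrt_of_sq_le (by nlinarith)
  have hconst : (π ^ n)⁻¹ * (r / √(1 - r ^ 2)) ^ n ≤ r ^ n := by
    rw [← inv_pow, ← mul_pow]
    gcongr
    calc π⁻¹ * (r / √(1 - r ^ 2)) ≤ 2⁻¹ * (r / (1 / 2)) := by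
          gcongr
          exact two_le_pi
      _ = r := by ring
  have hexponent : -(‖x‖ ^ 2 + ‖y‖ ^ 2 - 2 * r * inner ℝ x y) / (1 - r ^ 2) ≤
      -‖x‖ ^ 2 + -‖r • x - y‖ ^ 2 := by
    have hsq := norm_sub_smul_sq r x y
    rw [norm_sub_rev, div_le_iff₀ hr2]
    nlinarith [mul_nonneg (sq_nonneg r) (sq_nonneg ‖y - r • x‖)]
  calc mehler r x y ≤ r ^ n * exp (-‖x‖ ^ 2 + -‖r • x - y‖ ^ 2) := by
        unfold mehler
        gcongr
    _ = _ := by rw [exp_add, mul_assoc]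

theorem exists_rpow_le_mul_exp (a : ℝ) {b : ℝ} (hb : 0 < b) :
    ∃ C : ℝ, 0 ≤ C ∧ ∀ t : ℝ, 1 ≤ t → t ^ a ≤ C * exp (b * t) := by
  obtain ⟨m, hm⟩ := exists_nat_ge a
  refine ⟨m.factorial / b ^ m, by positivity, fun t ht => ?_⟩
  have hpow := pow_div_factorial_le_exp (b * t) (by positivity) m
  rw [mul_pow, div_le_iff₀ (by positivity)] at hpow
  calc t ^ a ≤ t ^ m := by
        rw [← rpow_natCast]
        exact rpow_le_rpow_of_exponent_le ht hm
    _ ≤ m.factorial / b ^ m * exp (b * t) := by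
        rw [div_mul_eq_mul_div, le_div_iff₀ (by positivity)]
        linarith

-- The decay `e^{-nt}` of the kernel is spent as `e^{-(n - 1/2)t}`, the degree of the potential, and
-- `e^{-t/2}`, which absorbs the factor `t^(β-1)`.
theorem exists_setLIntegral_Ioi_one_semigroupKernel_le (n : ℕ) (β : ℝ) :
    ∃ C : ℝ, 0 ≤ C ∧ ∀ x y : E n,
      ∫⁻ t in Ioi 1, semigroupKernel t x y ∂(riemannLiouville β) ≤
        ENNReal.ofReal (exp (-‖x‖ ^ 2)) * dilationPotential ((n : ℝ) - 1 / 2)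
          (fun z => ENNReal.ofReal (C * exp (-‖z - y‖ ^ 2))) x := by
  obtain ⟨C, hC0, hC⟩ := exists_rpow_le_mul_exp (β - 1) one_half_pos
  refine ⟨C * |(Gamma β)⁻¹|, by positivity, fun x y => ?_⟩
  have hbound : ∀ t : ℝ, 1 < t → t ^ (β - 1) / Gamma β * mehler (exp (-t)) x y ≤
      exp (-‖x‖ ^ 2) * (exp (-((n : ℝ) - 1 / 2) * t) *
        (C * |(Gamma β)⁻¹| * exp (-‖exp (-t) • x - y‖ ^ 2))) := fun t ht => by
    have hr : exp (-t) ≤ 1 / 2 := by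
      rw [exp_neg, ← one_div]
      exact one_div_le_one_div_of_le two_pos (by linarith [add_one_le_exp t])
    calc t ^ (β - 1) / Gamma β * mehler (exp (-t)) x y
        ≤ t ^ (β - 1) * |(Gamma β)⁻¹| * mehler (exp (-t)) x y := by
          rw [div_eq_mul_inv]
          gcongr
          · exact mehler_nonneg (exp_pos _).le x y
          · exact le_abs_self _
      _ ≤ C * exp (1 / 2 * t) * |(Gamma β)⁻¹| *
          (exp (-t) ^ n * exp (-‖x‖ ^ 2) * exp (-‖exp (-t) • x - y‖ ^ 2)) := by
          have := mehler_nonneg (exp_pos (-t)).le x y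
          gcongr
          · exact hC t ht.le
          · exact mehler_le_of_le_half (exp_pos _).le hr x y
      _ = _ := by
          rw [← exp_nat_mul, show -((n : ℝ) - 1 / 2) * t = 1 / 2 * t + n * -t by ring, exp_add]
          ring
  rw [← lintegral_indicator measurableSet_Ioi, lintegral_riemannLiouville, dilationPotential,
    ← lintegral_const_mul' _ _ ENNReal.ofReal_ne_top]
  refine (setLIntegral_le_lintegral _ _).trans (lintegral_mono fun t => ?_)
  by_cases ht : t ∈ Ioi (1 : ℝ)
  · rw [indicator_of_mem ht, semigroupKernel,
      ← ENNReal.ofReal_mul' (mehler_nonneg (exp_pos _).le _ _), ← ENNReal.ofReal_mul (exp_pos _).le,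
      ← ENNReal.ofReal_mul (exp_pos _).le]
    exact ENNReal.ofReal_le_ofReal (hbound t ht)
  · simp [indicator_of_notMem ht]

theorem hasWeakTypeOne_setLIntegral_Iic_one_semigroupKernel {β : ℝ} (hβ : 0 < β) (n : ℕ) :
    HasWeakTypeOne (gammaInv n) (gammaInv n)
      (fun x y => ∫⁻ t in Iic 1, semigroupKernel t x y ∂(riemannLiouville β))
      (riemannLiouville β (Iic 1)).toNNReal := by
  refine hasWeakTypeOne_of_lintegral_le (Measurable.lintegral_prod_right
    (f := fun (z : E n × E n) t => semigroupKernel t z.1 z.2)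
    (measurable_semigroupKernel (by fun_prop) (by fun_prop) (by fun_prop))) fun y => ?_
  rw [ENNReal.coe_toNNReal (riemannLiouville_Iic_one_lt_top hβ).ne, lintegral_lintegral_swap
    (measurable_semigroupKernel (by fun_prop) (by fun_prop) (by fun_prop)).aemeasurable]
  calc _ = ∫⁻ _ in Iic 1, 1 ∂(riemannLiouville β) := by
        refine lintegral_congr_ae ?_
        filter_upwards [ae_restrict_of_ae (ae_pos_riemannLiouville β)] with t ht
        simp_rw [semigroupKernel_comm t _ y]
        exact lintegral_semigroupKernel ht y
    _ ≤ _ := by simp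

theorem exists_hasWeakTypeOne_negPowKernel (hn : 0 < n) {β : ℝ} (hβ : 0 < β) :
    ∃ C : ℝ≥0, HasWeakTypeOne (gammaInv n) (gammaInv n) (negPowKernel β) C := by
  obtain ⟨C, hC0, hlarge⟩ := exists_setLIntegral_Ioi_one_semigroupKernel_le n β
  obtain ⟨A, hA⟩ := exists_lintegral_norm_rpow_mul_gaussian_le hn hC0
  have hweak := hasWeakTypeOne_dilationPotential (ν := gammaInv n) hn (by fun_prop) hA
  refine ⟨_, (hasWeakTypeOne_setLIntegral_Iic_one_semigroupKernel hβ n).of_le_add hweak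
    (fun x => ?_) fun x y => ?_⟩
  · exact Measurable.lintegral_prod_right (f := fun (y : E n) t => semigroupKernel t x y)
      (measurable_semigroupKernel (by fun_prop) (by fun_prop) (by fun_prop))
  · rw [negPowKernel, ← lintegral_add_compl _ measurableSet_Iic, compl_Iic]
    gcongr
    exact hlarge x y

end SmallAndLargeTimes

section HermiteFunctions

/-- The one-dimensional eigenfunction `e^{-z²} H_m(z)`; `hermiteTilde` is a product of these. -/
def hermiteFun (m : ℕ) (z : ℝ) : ℝ := hermite1 m z * exp (-z ^ 2)

theorem hermite1_eq_exp_sq_mul_hermiteFun (m : ℕ) (z : ℝ) :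
    hermite1 m z = exp (z ^ 2) * hermiteFun m z := by
  rw [hermiteFun, mul_left_comm, ← exp_add, add_neg_cancel, exp_zero, mul_one]

theorem hermiteFun_eq_iteratedDeriv (m : ℕ) (z : ℝ) :
    hermiteFun m z = (-1) ^ m * iteratedDeriv m (fun w : ℝ => exp (-w ^ 2)) z := by
  rw [hermiteFun, hermite1, mul_right_comm, mul_assoc ((-1) ^ m), ← exp_add, add_neg_cancel,
    exp_zero, mul_one]

theorem hermite1_zero (z : ℝ) : hermite1 0 z = 1 := by
  simp [hermite1, ← exp_add]

theorem hermiteFun_zero (z : ℝ) : hermiteFun 0 z = exp (-z ^ 2) := by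
  rw [hermiteFun, hermite1_zero, one_mul]

theorem hasDerivAt_hermiteFun (m : ℕ) (z : ℝ) :
    HasDerivAt (hermiteFun m) (-hermiteFun (m + 1) z) z := by
  have hsmooth : ContDiff ℝ ⊤ fun w : ℝ => exp (-w ^ 2) := by fun_prop
  have hdiff : Differentiable ℝ (iteratedDeriv m fun w : ℝ => exp (-w ^ 2)) :=
    hsmooth.differentiable_iteratedDeriv m (mod_cast WithTop.coe_lt_top _)
  rw [funext (hermiteFun_eq_iteratedDeriv m), hermiteFun_eq_iteratedDeriv, iteratedDeriv_succ]
  convert! (hdiff z).hasDerivAt.const_mul ((-1 : ℝ) ^ m) using 1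
  ring

theorem hermiteFun_one (z : ℝ) : hermiteFun 1 z = 2 * z * hermiteFun 0 z := by
  have hgauss : HasDerivAt (hermiteFun 0) (exp (-z ^ 2) * -(2 * z)) z := by
    rw [funext hermiteFun_zero]
    simpa using (hasDerivAt_pow 2 z).fun_neg.exp
  rw [hermiteFun_zero]
  linarith [(hasDerivAt_hermiteFun 0 z).unique hgauss]

theorem hasDerivAt_two_mul_mul_hermiteFun (m : ℕ) (z : ℝ) :
    HasDerivAt (fun z => 2 * z * hermiteFun m z)
      (2 * hermiteFun m z - 2 * z * hermiteFun (m + 1) z) z :=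
  (((hasDerivAt_id z).const_mul 2).fun_mul (hasDerivAt_hermiteFun m z)).congr_deriv
    (by simp only [id]; ring)

theorem hermiteFun_add_two (m : ℕ) (z : ℝ) :
    hermiteFun (m + 2) z = 2 * z * hermiteFun (m + 1) z - 2 * (m + 1) * hermiteFun m z := by
  induction m generalizing z with
  | zero =>
    have hderiv := hasDerivAt_hermiteFun 1 z
    rw [funext hermiteFun_one] at hderiv
    push_cast
    linarith [(hasDerivAt_two_mul_mul_hermiteFun 0 z).unique hderiv]
  | succ m ih =>
    have hderiv := hasDerivAt_hermiteFun (m + 2) z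
    rw [funext ih] at hderiv
    push_cast
    linarith [((hasDerivAt_two_mul_mul_hermiteFun (m + 1) z).fun_sub
      ((hasDerivAt_hermiteFun m z).const_mul _)).unique hderiv]

theorem hermite1_one (z : ℝ) : hermite1 1 z = 2 * z * hermite1 0 z := by
  simp only [hermite1_eq_exp_sq_mul_hermiteFun, hermiteFun_one]
  ring

theorem hermite1_add_two (m : ℕ) (z : ℝ) :
    hermite1 (m + 2) z = 2 * z * hermite1 (m + 1) z - 2 * (m + 1) * hermite1 m z := by
  simp only [hermite1_eq_exp_sq_mul_hermiteFun, hermiteFun_add_two]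
  ring

theorem hasDerivAt_hermite1_succ (m : ℕ) (z : ℝ) :
    HasDerivAt (hermite1 (m + 1)) (2 * (m + 1) * hermite1 m z) z := by
  rw [funext (hermite1_eq_exp_sq_mul_hermiteFun (m + 1))]
  refine ((hasDerivAt_pow 2 z).exp.fun_mul (hasDerivAt_hermiteFun (m + 1) z)).congr_deriv ?_
  rw [hermiteFun_add_two, hermite1_eq_exp_sq_mul_hermiteFun]
  push_cast
  ring

theorem exists_abs_eval_le_mul_exp_sq (P : Polynomial ℝ) :
    ∃ C : ℝ, ∀ z, |P.eval z| ≤ C * exp (z ^ 2) := by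
  induction P using Polynomial.induction_on' with
  | add p q hp hq =>
    obtain ⟨C, hC⟩ := hp
    obtain ⟨D, hD⟩ := hq
    refine ⟨C + D, fun z => ?_⟩
    rw [Polynomial.eval_add, add_mul]
    exact (abs_add_le _ _).trans (add_le_add (hC z) (hD z))
  | monomial m a =>
    refine ⟨|a| * (m.factorial * exp 1), fun z => ?_⟩
    have hpow : |z| ^ m ≤ exp |z| * m.factorial :=
      (div_le_iff₀ (by positivity)).1 (pow_div_factorial_le_exp |z| (abs_nonneg z) m)
    have hexp : exp |z| ≤ exp 1 * exp (z ^ 2) := by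
      rw [← exp_add, exp_le_exp]
      nlinarith [sq_abs z, sq_nonneg (|z| - 1)]
    rw [Polynomial.eval_monomial, abs_mul, abs_pow]
    calc |a| * |z| ^ m ≤ |a| * (exp 1 * exp (z ^ 2) * m.factorial) := by grw [hpow, hexp]
      _ = |a| * (m.factorial * exp 1) * exp (z ^ 2) := by ring

theorem exists_abs_hermiteFun_le (m : ℕ) : ∃ C, ∀ z, |hermiteFun m z| ≤ C := by
  obtain ⟨P, hP⟩ := hermite1_eq_poly m
  obtain ⟨C, hC⟩ := exists_abs_eval_le_mul_exp_sq P
  refine ⟨C, fun z => ?_⟩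
  rw [hermiteFun, hP, abs_mul, abs_exp, exp_neg, ← div_eq_mul_inv, div_le_iff₀ (exp_pos _)]
  exact hC z

end HermiteFunctions

section Orthogonality

theorem integrable_hermite1_mul_hermiteFun (l m : ℕ) :
    Integrable fun z => hermite1 l z * hermiteFun m z := by
  obtain ⟨P, hP⟩ := hermite1_eq_poly l
  obtain ⟨Q, hQ⟩ := hermite1_eq_poly m
  simpa only [hermiteFun, hP, hQ, Polynomial.eval_mul, mul_assoc] using
    integrable_poly_mul_gaussian (P * Q)

theorem integral_hermite1_zero_mul_hermiteFun_succ (m : ℕ) :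
    ∫ z, hermite1 0 z * hermiteFun (m + 1) z = 0 := by
  have hint (l : ℕ) := integrable_hermite1_mul_hermiteFun 0 l
  simp only [hermite1_zero, one_mul] at hint ⊢
  simpa only [integral_neg, neg_eq_zero] using integral_eq_zero_of_hasDerivAt_of_integrable
    (hasDerivAt_hermiteFun m) (hint (m + 1)).neg (hint m)

theorem integral_hermite1_succ_mul_hermiteFun_succ (l m : ℕ) :
    ∫ z, hermite1 (l + 1) z * hermiteFun (m + 1) z =
      2 * (l + 1) * ∫ z, hermite1 l z * hermiteFun m z := by
  have hderiv (z : ℝ) : HasDerivAt (fun z => hermite1 (l + 1) z * hermiteFun m z)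
      (2 * (l + 1) * (hermite1 l z * hermiteFun m z) - hermite1 (l + 1) z * hermiteFun (m + 1) z)
      z :=
    ((hasDerivAt_hermite1_succ l z).fun_mul (hasDerivAt_hermiteFun m z)).congr_deriv (by ring)
  have hint := (integrable_hermite1_mul_hermiteFun l m).const_mul (2 * ((l : ℝ) + 1))
  have hint' := integrable_hermite1_mul_hermiteFun (l + 1) (m + 1)
  have hzero := integral_eq_zero_of_hasDerivAt_of_integrable hderiv (hint.sub hint')
    (integrable_hermite1_mul_hermiteFun (l + 1) m)
  rw [integral_sub hint hint', integral_const_mul] at hzero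
  linarith

theorem integral_hermite1_mul_hermiteFun_of_ne {l m : ℕ} (h : l ≠ m) :
    ∫ z, hermite1 l z * hermiteFun m z = 0 := by
  induction l generalizing m with
  | zero =>
    obtain ⟨m, rfl⟩ := Nat.exists_eq_succ_of_ne_zero h.symm
    exact integral_hermite1_zero_mul_hermiteFun_succ m
  | succ l ih =>
    rcases m with _ | m
    · rw [← integral_hermite1_zero_mul_hermiteFun_succ l]
      exact integral_congr_ae (.of_forall fun z => by simp only [hermiteFun]; ring)
    · rw [integral_hermite1_succ_mul_hermiteFun_succ, ih (by lia), mul_zero]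

theorem integral_hermite1_mul_hermiteFun_self_pos (m : ℕ) :
    0 < ∫ z, hermite1 m z * hermiteFun m z := by
  induction m with
  | zero =>
    have hgauss : ∫ z : ℝ, exp (-z ^ 2) = √π := by simpa using integral_gaussian 1
    simp only [hermite1_zero, hermiteFun_zero, one_mul, hgauss]
    positivity
  | succ m ih =>
    rw [integral_hermite1_succ_mul_hermiteFun_succ]
    positivity

theorem hermiteTilde_eq_prod (k : Fin n → ℕ) (x : E n) :
    hermiteTilde k x = ∏ i, hermiteFun (k i) (x i) := by
  simp only [hermiteTilde, hermiteN, hermiteFun, Finset.prod_mul_distrib, ← exp_sum,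
    EuclideanSpace.real_norm_sq_eq, Finset.sum_neg_distrib]
  ring

theorem integral_euclideanSpace_prod (f : Fin n → ℝ → ℝ) :
    ∫ y : E n, ∏ i, f i (y i) = ∏ i, ∫ z, f i z := by
  rw [← integral_fintype_prod_volume_eq_prod,
    ← (PiLp.volume_preserving_toLp (Fin n)).integral_comp
      (MeasurableEquiv.toLp 2 _).measurableEmbedding]

theorem integral_hermiteTilde_mul_hermiteTilde (k l : Fin n → ℕ) :
    ∫ y, hermiteTilde k y * hermiteTilde l y ∂(gammaInv n) =
      √π ^ n * ∏ i, ∫ z, hermite1 (k i) z * hermiteFun (l i) z := by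
  rw [integral_gammaInv, ← integral_euclideanSpace_prod, ← integral_const_mul]
  refine integral_congr_ae (.of_forall fun y => ?_)
  have hcancel : exp (‖y‖ ^ 2) * exp (-‖y‖ ^ 2) = 1 := by
    rw [← exp_add, add_neg_cancel, exp_zero]
  simp only [smul_eq_mul, Finset.prod_mul_distrib, ← hermiteTilde_eq_prod]
  rw [hermiteTilde, hermiteN]
  linear_combination (√π ^ n * (∏ i, hermite1 (k i) (y i)) * hermiteTilde l y) * hcancel

theorem integral_hermiteTilde_mul_hermiteTilde_of_ne {k l : Fin n → ℕ} (h : k ≠ l) :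
    ∫ y, hermiteTilde k y * hermiteTilde l y ∂(gammaInv n) = 0 := by
  obtain ⟨i, hi⟩ := Function.ne_iff.1 h
  rw [integral_hermiteTilde_mul_hermiteTilde,
    Finset.prod_eq_zero (Finset.mem_univ i) (integral_hermite1_mul_hermiteFun_of_ne hi), mul_zero]

theorem integral_hermiteTilde_sq_pos (k : Fin n → ℕ) :
    0 < ∫ y, hermiteTilde k y ^ 2 ∂(gammaInv n) := by
  simp only [sq, integral_hermiteTilde_mul_hermiteTilde]
  exact mul_pos (by positivity)
    (Finset.prod_pos fun i _ => integral_hermite1_mul_hermiteFun_self_pos (k i))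

end Orthogonality

section MehlerFormula

theorem hasDerivAt_integral_smul_comp_sub {F : Type*} [NormedAddCommGroup F] [NormedSpace ℝ F]
    [CompleteSpace F] {μ : Measure ℝ} {f : ℝ → ℝ} {g g' : ℝ → F} {C C' : ℝ} (hf : Integrable f μ)
    (hg : ∀ z, HasDerivAt g (g' z) z) (hC : ∀ z, ‖g z‖ ≤ C) (hC' : ∀ z, ‖g' z‖ ≤ C') (x : ℝ) :
    HasDerivAt (fun x => ∫ u, f u • g (x - u) ∂μ) (∫ u, f u • g' (x - u) ∂μ) x := by
  have hgcont : Continuous g := continuous_iff_continuousAt.2 fun z => (hg z).continuousAt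
  have hg'meas : StronglyMeasurable g' := by
    rw [← deriv_eq hg]
    exact stronglyMeasurable_deriv g
  have hmeas (y : ℝ) : AEStronglyMeasurable (fun u => f u • g (y - u)) μ :=
    hf.1.smul (hgcont.comp (by fun_prop)).aestronglyMeasurable
  refine (hasDerivAt_integral_of_dominated_loc_of_deriv_le (F := fun y u => f u • g (y - u))
    (F' := fun y u => f u • g' (y - u)) (bound := fun u => ‖f u‖ * C') Filter.univ_mem
    (.of_forall hmeas) ?_ ?_ (.of_forall fun u y _ => ?_) (hf.norm.mul_const C')
    (.of_forall fun u y _ => ?_)).2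
  · exact (hf.norm.mul_const C).mono' (hmeas x) (.of_forall fun u => by
      grw [norm_smul, hC])
  · exact hf.1.smul (hg'meas.comp_measurable (by fun_prop)).aestronglyMeasurable
  · grw [norm_smul, hC']
  · exact ((hg (y - u)).comp_sub_const y u).const_smul (f u)

theorem integral_gaussian_mul_hermiteFun_comp_sub {r : ℝ} (hr0 : 0 < r) (hr1 : r < 1) (m : ℕ)
    (x : ℝ) :
    ∫ u, exp (-(r ^ 2 / (1 - r ^ 2)) * u ^ 2) * hermiteFun m (x - u) =
      √π * √(1 - r ^ 2) * r ^ m * hermiteFun m (r * x) := by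
  have hr2 : 0 < 1 - r ^ 2 := by nlinarith
  induction m generalizing x with
  | zero =>
    have complete_square (u : ℝ) :
        exp (-(r ^ 2 / (1 - r ^ 2)) * u ^ 2) * hermiteFun 0 (x - u) =
          exp (-(r * x) ^ 2) * exp (-(1 / (1 - r ^ 2)) * (u - (1 - r ^ 2) * x) ^ 2) := by
      rw [hermiteFun_zero, ← exp_add, ← exp_add]
      congr 1
      field_simp
      ring
    simp only [complete_square]
    rw [integral_const_mul, integral_sub_right_eq_self
      (fun u => exp (-(1 / (1 - r ^ 2)) * u ^ 2)), integral_gaussian, one_div, div_inv_eq_mul,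
      sqrt_mul pi_pos.le, hermiteFun_zero]
    ring
  | succ m ih =>
    obtain ⟨C, hC⟩ := exists_abs_hermiteFun_le m
    obtain ⟨C', hC'⟩ := exists_abs_hermiteFun_le (m + 1)
    have hgauss := integrable_exp_neg_mul_sq (div_pos (pow_pos hr0 2) hr2)
    have hleft : HasDerivAt (fun x => √π * √(1 - r ^ 2) * r ^ m * hermiteFun m (r * x))
        (-∫ u, exp (-(r ^ 2 / (1 - r ^ 2)) * u ^ 2) * hermiteFun (m + 1) (x - u)) x := by
      simpa only [smul_eq_mul, ih, mul_neg, integral_neg] using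
        hasDerivAt_integral_smul_comp_sub hgauss (hasDerivAt_hermiteFun m) hC
          (fun z => (norm_neg _).trans_le (hC' z)) x
    have hright := ((hasDerivAt_hermiteFun m (r * x)).comp x
      ((hasDerivAt_id x).const_mul r)).const_mul (√π * √(1 - r ^ 2) * r ^ m)
    rw [pow_succ r m]
    linear_combination -(hleft.unique hright)

theorem integral_mehlerFactor_mul_hermiteFun {r : ℝ} (hr0 : 0 < r) (hr1 : r < 1) (m : ℕ)
    (x : ℝ) :
    ∫ y, √π * (π⁻¹ * (r / √(1 - r ^ 2))) * exp (-(r ^ 2 / (1 - r ^ 2)) * (r⁻¹ * x - y) ^ 2) *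
      hermiteFun m y = r ^ (m + 1) * hermiteFun m x := by
  have hshift := integral_gaussian_mul_hermiteFun_comp_sub hr0 hr1 m (r⁻¹ * x)
  rw [mul_inv_cancel_left₀ hr0.ne', ← integral_sub_left_eq_self _ volume (r⁻¹ * x)] at hshift
  simp only [sub_sub_cancel] at hshift
  simp only [mul_assoc _ (exp _)]
  rw [integral_const_mul, hshift]
  have : 0 < √(1 - r ^ 2) := sqrt_pos.2 (by nlinarith)
  have hpi : √π ^ 2 = π := sq_sqrt pi_pos.le
  field_simp
  rw [hpi]
  ring

theorem exp_sq_mul_mehler_eq_prod {r : ℝ} (hr0 : 0 < r) (hr1 : r < 1) (x y : E n) :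
    √π ^ n * exp (‖y‖ ^ 2) * mehler r x y =
      ∏ i, (√π * (π⁻¹ * (r / √(1 - r ^ 2))) *
        exp (-(r ^ 2 / (1 - r ^ 2)) * (r⁻¹ * x i - y i) ^ 2)) := by
  have hr2 : 0 < 1 - r ^ 2 := by nlinarith
  have hsq := exp_sq_mul_mehler_mul_exp hr2 (pow_pos hr0 2) (a := 0) (by ring) x y
  have hnorm : ‖y - r⁻¹ • x‖ ^ 2 = ∑ i, (r⁻¹ * x i - y i) ^ 2 := by
    rw [norm_sub_rev, EuclideanSpace.real_norm_sq_eq]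
    rfl
  simp only [neg_zero, zero_div, zero_mul, exp_zero, mul_one] at hsq
  rw [hsq, sq r, div_mul_cancel_left₀ hr0.ne', hnorm, Finset.prod_mul_distrib, Finset.prod_const,
    Finset.card_univ, Fintype.card_fin, ← exp_sum, ← Finset.mul_sum, mul_pow, mul_pow, inv_pow]

theorem integral_mehler_mul_hermiteTilde {r : ℝ} (hr0 : 0 < r) (hr1 : r < 1) (k : Fin n → ℕ)
    (x : E n) :
    ∫ y, mehler r x y * hermiteTilde k y ∂(gammaInv n) =
      r ^ ((∑ i, k i) + n) * hermiteTilde k x := by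
  simp only [integral_gammaInv, smul_eq_mul, ← mul_assoc, hermiteTilde_eq_prod]
  simp only [exp_sq_mul_mehler_eq_prod hr0 hr1, ← Finset.prod_mul_distrib]
  rw [integral_euclideanSpace_prod fun i z => √π * (π⁻¹ * (r / √(1 - r ^ 2))) *
    exp (-(r ^ 2 / (1 - r ^ 2)) * (r⁻¹ * x i - z) ^ 2) * hermiteFun (k i) z]
  simp only [integral_mehlerFactor_mul_hermiteFun hr0 hr1, Finset.prod_mul_distrib,
    Finset.prod_pow_eq_pow_sum, Finset.sum_add_distrib, Finset.sum_const, Finset.card_univ,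
    Fintype.card_fin, smul_eq_mul, mul_one]

end MehlerFormula

section ExponentialMoments

theorem integral_cexp_mul_I_mul_eq_zero {α : Type*} [MeasurableSpace α] {μ : Measure α}
    {f w : α → ℝ} (hf : AEStronglyMeasurable f μ) (hw : AEStronglyMeasurable w μ)
    (hexp : Integrable (fun a => exp |f a| * w a) μ) (hmom : ∀ m : ℕ, ∫ a, f a ^ m * w a ∂μ = 0) :
    ∫ a, Complex.exp (f a * Complex.I) * w a ∂μ = 0 := by
  have hterm (m : ℕ) : ∫ a, (f a * Complex.I) ^ m / (m.factorial : ℂ) * w a ∂μ = 0 := by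
    have hcast (a : α) : (f a * Complex.I) ^ m / (m.factorial : ℂ) * w a =
        Complex.I ^ m / (m.factorial : ℂ) * (f a ^ m * w a : ℝ) := by
      push_cast
      ring
    simp only [hcast]
    rw [integral_const_mul, integral_complex_ofReal, hmom, Complex.ofReal_zero, mul_zero]
  have htsum (a : α) : ∑' m : ℕ, |f a| ^ m / m.factorial * |w a| = exp |f a| * |w a| := by
    rw [tsum_mul_right, exp_eq_exp_ℝ, NormedSpace.exp_eq_tsum_div]
  have hsum := hasSum_integral_of_dominated_convergence (μ := μ)
    (F := fun (m : ℕ) a => (f a * Complex.I) ^ m / (m.factorial : ℂ) * w a)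
    (f := fun a => Complex.exp (f a * Complex.I) * w a)
    (fun m a => |f a| ^ m / m.factorial * |w a|) (fun m => by fun_prop)
    (fun m => .of_forall fun a => by simp)
    (.of_forall fun a => (summable_pow_div_factorial _).mul_right _)
    (by simpa only [htsum, norm_mul, norm_eq_abs, abs_exp] using hexp.norm)
    (.of_forall fun a => by
      simpa only [Complex.exp_eq_exp_ℂ] using
        (NormedSpace.expSeries_div_hasSum_exp (𝔸 := ℂ) (f a * Complex.I)).mul_right (w a : ℂ))
  simp only [hterm] at hsum
  exact hsum.unique hasSum_zero

variable {V : Type*} [NormedAddCommGroup V] [InnerProductSpace ℝ V] [MeasurableSpace V]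
  [BorelSpace V] {μ : Measure V}

theorem integrable_toReal_ofReal_smul_cexp {w : V → ℝ} (hw : Integrable w μ) (ξ : V) :
    Integrable (fun y => (ENNReal.ofReal (w y)).toReal • Complex.exp (inner ℝ y ξ * Complex.I))
      μ := by
  simp only [ENNReal.toReal_ofReal']
  exact hw.pos_part.smul_bdd 1 (by fun_prop)
    (.of_forall fun y => (Complex.norm_exp_ofReal_mul_I _).le)

theorem ae_eq_zero_of_integral_cexp_inner_mul_eq_zero [CompleteSpace V]
    [SecondCountableTopology V] [SigmaFinite μ] {w : V → ℝ} (hw : Integrable w μ)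
    (h : ∀ ξ, ∫ y, Complex.exp (inner ℝ y ξ * Complex.I) * w y ∂μ = 0) : w =ᵐ[μ] 0 := by
  have hmeas := hw.aemeasurable
  have : IsFiniteMeasure (μ.withDensity fun y => ENNReal.ofReal (w y)) :=
    isFiniteMeasure_withDensity_ofReal hw.2
  have : IsFiniteMeasure (μ.withDensity fun y => ENNReal.ofReal (-w y)) :=
    isFiniteMeasure_withDensity_ofReal hw.neg.2
  have hparts : (μ.withDensity fun y => ENNReal.ofReal (w y)) =
      μ.withDensity fun y => ENNReal.ofReal (-w y) := by
    refine Measure.ext_of_charFun (funext fun ξ => ?_)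
    have hpos := integrable_toReal_ofReal_smul_cexp hw ξ
    have hneg := integrable_toReal_ofReal_smul_cexp hw.fun_neg ξ
    rw [charFun_apply, charFun_apply,
      integral_withDensity_eq_integral_toReal_smul₀ (by fun_prop) (by simp),
      integral_withDensity_eq_integral_toReal_smul₀ (by fun_prop) (by simp), ← sub_eq_zero,
      ← integral_sub hpos hneg, ← h ξ]
    refine integral_congr_ae (.of_forall fun y => ?_)
    dsimp only
    rw [← sub_smul, ENNReal.toReal_ofReal', ENNReal.toReal_ofReal',
      max_zero_sub_max_neg_zero_eq_self, Complex.real_smul, mul_comm]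
  rw [withDensity_eq_iff_of_sigmaFinite (by fun_prop) (by fun_prop)] at hparts
  filter_upwards [hparts] with y hy
  rw [Pi.zero_apply, ← max_zero_sub_max_neg_zero_eq_self (w y), ← ENNReal.toReal_ofReal',
    ← ENNReal.toReal_ofReal', hy, sub_self]

theorem ae_eq_zero_of_integral_inner_pow_mul_eq_zero [CompleteSpace V]
    [SecondCountableTopology V] [SigmaFinite μ] {w : V → ℝ}
    (hexp : ∀ c : ℝ, Integrable (fun y => exp (c * ‖y‖) * w y) μ)
    (hmom : ∀ (ξ : V) (m : ℕ), ∫ y, inner ℝ y ξ ^ m * w y ∂μ = 0) : w =ᵐ[μ] 0 := by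
  have hw : Integrable w μ := by simpa using hexp 0
  refine ae_eq_zero_of_integral_cexp_inner_mul_eq_zero hw fun ξ => ?_
  have hmeas := hw.1
  refine integral_cexp_mul_I_mul_eq_zero (by fun_prop) hmeas ?_ (hmom ξ)
  refine (hexp ‖ξ‖).mono (by fun_prop) (.of_forall fun y => ?_)
  rw [norm_mul, norm_mul, norm_eq_abs (exp _), norm_eq_abs (exp _), abs_exp, abs_exp]
  grw [abs_real_inner_le_norm, mul_comm ‖y‖]

end ExponentialMoments

section Completeness

/-- The linear span of the Hermite polynomials `H_k`. A function orthogonal to all the `H̃_k` is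
orthogonal to everything in this span, in particular to the powers of linear forms. -/
def hermiteSpan (n : ℕ) : Submodule ℝ (E n → ℝ) := Submodule.span ℝ (range hermiteN)

theorem hermiteN_mem_hermiteSpan (k : Fin n → ℕ) : hermiteN k ∈ hermiteSpan n :=
  Submodule.subset_span ⟨k, rfl⟩

theorem hermiteN_update (k : Fin n → ℕ) (i : Fin n) (m : ℕ) (x : E n) :
    hermiteN (Function.update k i m) x =
      hermite1 m (x i) * ∏ j ∈ Finset.univ.erase i, hermite1 (k j) (x j) := by
  rw [hermiteN, ← Finset.mul_prod_erase _ _ (Finset.mem_univ i), Function.update_self]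
  congr 1
  refine Finset.prod_congr rfl fun j hj => ?_
  rw [Function.update_of_ne (Finset.ne_of_mem_erase hj)]

theorem coord_mul_hermiteN_mem_hermiteSpan (i : Fin n) (k : Fin n → ℕ) :
    (fun x : E n => x i * hermiteN k x) ∈ hermiteSpan n := by
  have hmem (m : ℕ) := hermiteN_mem_hermiteSpan (Function.update k i m)
  rw [← Function.update_eq_self i k]
  rcases k i with _ | m
  · convert! (hermiteSpan n).smul_mem (1 / 2 : ℝ) (hmem 1) using 1
    ext x
    simp only [Pi.smul_apply, smul_eq_mul, hermiteN_update, hermite1_one]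
    ring
  · convert! (hermiteSpan n).add_mem ((hermiteSpan n).smul_mem (1 / 2 : ℝ) (hmem (m + 2)))
      ((hermiteSpan n).smul_mem ((m : ℝ) + 1) (hmem m)) using 1
    ext x
    simp only [Pi.smul_apply, Pi.add_apply, smul_eq_mul, hermiteN_update, hermite1_add_two]
    ring

theorem coord_mul_mem_hermiteSpan (i : Fin n) {P : E n → ℝ} (hP : P ∈ hermiteSpan n) :
    (fun x : E n => x i * P x) ∈ hermiteSpan n := by
  have hle : hermiteSpan n ≤
      (hermiteSpan n).comap (LinearMap.mulLeft ℝ fun x : E n => x i) := by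
    refine Submodule.span_le.2 ?_
    rintro _ ⟨k, rfl⟩
    exact coord_mul_hermiteN_mem_hermiteSpan i k
  exact hle hP

theorem inner_pow_mem_hermiteSpan (ξ : E n) (m : ℕ) :
    (fun x : E n => inner ℝ x ξ ^ m) ∈ hermiteSpan n := by
  induction m with
  | zero =>
    convert! hermiteN_mem_hermiteSpan (0 : Fin n → ℕ) using 1
    ext x
    simp [hermiteN, hermite1_zero]
  | succ m ih =>
    convert! (hermiteSpan n).sum_mem (t := Finset.univ) fun i _ =>
      (hermiteSpan n).smul_mem (ξ i) (coord_mul_mem_hermiteSpan i ih) using 1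
    ext x
    simp only [Finset.sum_apply, Pi.smul_apply, smul_eq_mul, ← mul_assoc, ← Finset.sum_mul]
    rw [pow_succ', PiLp.inner_apply]
    rfl

theorem memLp_exp_neg_sq_add_linear (c : ℝ) :
    MemLp (fun x : E n => exp (-‖x‖ ^ 2 + c * ‖x‖)) 2 (gammaInv n) := by
  rw [memLp_two_iff_integrable_sq (by fun_prop), gammaInv,
    integrable_withDensity_iff (by fun_prop) (by simp)]
  have hgauss : Integrable fun x : E n => exp (-(1 / 2) * ‖x‖ ^ 2) :=
    integrable_exp_neg_mul_sq_norm (by norm_num)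
  refine (hgauss.const_mul (√π ^ n * exp (2 * c ^ 2))).mono' (by fun_prop)
    (.of_forall fun x => ?_)
  rw [ENNReal.toReal_ofReal (by positivity), pi_rpow_half, norm_of_nonneg (by positivity)]
  have hexponent :
      2 * (-‖x‖ ^ 2 + c * ‖x‖) + ‖x‖ ^ 2 ≤ 2 * c ^ 2 + -(1 / 2) * ‖x‖ ^ 2 := by
    linarith [sq_nonneg (‖x‖ - 2 * c)]
  calc exp (-‖x‖ ^ 2 + c * ‖x‖) ^ 2 * (√π ^ n * exp (‖x‖ ^ 2))
    _ = √π ^ n * exp (2 * (-‖x‖ ^ 2 + c * ‖x‖) + ‖x‖ ^ 2) := by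
      rw [← exp_nat_mul, exp_add (2 * _)]
      push_cast
      ring
    _ ≤ √π ^ n * exp (2 * c ^ 2 + -(1 / 2) * ‖x‖ ^ 2) := by gcongr
    _ = √π ^ n * exp (2 * c ^ 2) * exp (-(1 / 2) * ‖x‖ ^ 2) := by rw [exp_add, mul_assoc]

theorem integral_mul_eq_zero_of_mem_hermiteSpan {u : E n → ℝ} (hu : MemLp u 2 (gammaInv n))
    (h : ∀ k, ∫ y, u y * hermiteTilde k y ∂(gammaInv n) = 0) {P : E n → ℝ}
    (hP : P ∈ hermiteSpan n) :
    Integrable (fun y => P y * (u y * exp (-‖y‖ ^ 2))) (gammaInv n) ∧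
      ∫ y, P y * (u y * exp (-‖y‖ ^ 2)) ∂(gammaInv n) = 0 := by
  induction hP using Submodule.span_induction with
  | mem P hP =>
    obtain ⟨k, rfl⟩ := hP
    have hcomm (y : E n) :
        hermiteN k y * (u y * exp (-‖y‖ ^ 2)) = u y * hermiteTilde k y := by
      rw [hermiteTilde]
      ring
    simp only [hcomm]
    exact ⟨hu.integrable_mul (memLp_hermiteTilde ℝ k), h k⟩
  | zero => simp
  | add P Q _ _ hP hQ =>
    simp only [Pi.add_apply, add_mul]
    exact ⟨hP.1.add hQ.1, by rw [integral_add hP.1 hQ.1, hP.2, hQ.2, add_zero]⟩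
  | smul a P _ hP =>
    simp only [Pi.smul_apply, smul_eq_mul, mul_assoc]
    exact ⟨hP.1.const_mul a, by rw [integral_const_mul, hP.2, mul_zero]⟩

theorem ae_eq_zero_of_integral_mul_hermiteTilde {u : E n → ℝ} (hu : MemLp u 2 (gammaInv n))
    (h : ∀ k, ∫ y, u y * hermiteTilde k y ∂(gammaInv n) = 0) : u =ᵐ[gammaInv n] 0 := by
  have hexp (c : ℝ) :
      Integrable (fun y => exp (c * ‖y‖) * (u y * exp (-‖y‖ ^ 2))) (gammaInv n) := by
    refine (hu.integrable_mul (memLp_exp_neg_sq_add_linear c)).congr (.of_forall fun y => ?_)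
    simp only [Pi.mul_apply, exp_add]
    ring
  have hzero := ae_eq_zero_of_integral_inner_pow_mul_eq_zero hexp fun ξ m =>
    (integral_mul_eq_zero_of_mem_hermiteSpan hu h (inner_pow_mem_hermiteSpan ξ m)).2
  filter_upwards [hzero] with y hy
  exact (mul_eq_zero.1 hy).resolve_right (exp_ne_zero _)

end Completeness

section HermiteExpansion

theorem hasSum_inner_div_norm_sq_smul {ι 𝕜 H : Type*} [RCLike 𝕜] [NormedAddCommGroup H]
    [InnerProductSpace 𝕜 H] [CompleteSpace H] {v : ι → H} (hv0 : ∀ k, v k ≠ 0)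
    (hv : Pairwise fun k l => inner 𝕜 (v k) (v l) = 0)
    (htotal : ∀ g, (∀ k, inner 𝕜 (v k) g = 0) → g = 0) (g : H) :
    HasSum (fun k => (inner 𝕜 (v k) g / ((‖v k‖ ^ 2 : ℝ) : 𝕜)) • v k) g := by
  have hunit : Orthonormal 𝕜 fun k => ((‖v k‖⁻¹ : ℝ) : 𝕜) • v k := by
    refine ⟨fun k => ?_, fun k l hkl => ?_⟩
    · rw [norm_smul, RCLike.norm_ofReal, abs_of_nonneg (by positivity),
        inv_mul_cancel₀ (norm_ne_zero_iff.2 (hv0 k))]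
    · simp only [inner_smul_left, inner_smul_right, hv hkl, mul_zero]
  have horth : (Submodule.span 𝕜 (range fun k => ((‖v k‖⁻¹ : ℝ) : 𝕜) • v k))ᗮ = ⊥ := by
    refine (Submodule.eq_bot_iff _).2 fun f hf => htotal f fun k => ?_
    have hk := (Submodule.mem_orthogonal _ _).1 hf _ (Submodule.subset_span ⟨k, rfl⟩)
    rw [inner_smul_left] at hk
    exact (mul_eq_zero.1 hk).resolve_left (by simpa using hv0 k)
  convert! (HilbertBasis.mkOfOrthogonalEqBot hunit horth).hasSum_repr g using 2 with k
  rw [HilbertBasis.repr_apply_apply, HilbertBasis.coe_mkOfOrthogonalEqBot, inner_smul_left,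
    smul_smul, RCLike.conj_ofReal]
  push_cast
  congr 1
  ring

variable {𝕜 : Type*} [RCLike 𝕜]

theorem coeFn_hermiteL2 (k : Fin n → ℕ) :
    hermiteL2 𝕜 k =ᵐ[gammaInv n] fun x => ((hermiteTilde k x : ℝ) : 𝕜) :=
  (memLp_hermiteTilde 𝕜 k).coeFn_toLp

theorem inner_hermiteL2 (k : Fin n → ℕ) (g : Lp 𝕜 2 (gammaInv n)) :
    inner 𝕜 (hermiteL2 𝕜 k) g = ∫ y, g y * ((hermiteTilde k y : ℝ) : 𝕜) ∂(gammaInv n) := by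
  rw [L2.inner_def]
  refine integral_congr_ae ?_
  filter_upwards [coeFn_hermiteL2 (𝕜 := 𝕜) k] with y hy
  rw [hy, RCLike.inner_apply, RCLike.conj_ofReal]

theorem inner_hermiteL2_hermiteL2 (k l : Fin n → ℕ) :
    inner 𝕜 (hermiteL2 𝕜 k) (hermiteL2 𝕜 l) =
      ((∫ y, hermiteTilde k y * hermiteTilde l y ∂(gammaInv n) : ℝ) : 𝕜) := by
  rw [inner_hermiteL2, ← integral_ofReal]
  refine integral_congr_ae ?_
  filter_upwards [coeFn_hermiteL2 (𝕜 := 𝕜) l] with y hy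
  rw [hy, mul_comm, RCLike.ofReal_mul]

theorem hermiteL2_ne_zero (k : Fin n → ℕ) : hermiteL2 𝕜 k ≠ 0 := by
  rw [← inner_self_ne_zero (𝕜 := 𝕜), inner_hermiteL2_hermiteL2, RCLike.ofReal_ne_zero]
  simpa only [sq] using (integral_hermiteTilde_sq_pos k).ne'

theorem inner_hermiteL2_of_ne {k l : Fin n → ℕ} (h : k ≠ l) :
    inner 𝕜 (hermiteL2 𝕜 k) (hermiteL2 𝕜 l) = 0 := by
  rw [inner_hermiteL2_hermiteL2, integral_hermiteTilde_mul_hermiteTilde_of_ne h,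
    RCLike.ofReal_zero]

theorem eq_zero_of_inner_hermiteL2_eq_zero {g : Lp 𝕜 2 (gammaInv n)}
    (h : ∀ k, inner 𝕜 (hermiteL2 𝕜 k) g = 0) : g = 0 := by
  have hg := Lp.memLp g
  have hint (k : Fin n → ℕ) : Integrable (fun y => g y * ((hermiteTilde k y : ℝ) : 𝕜))
      (gammaInv n) := hg.integrable_mul (memLp_hermiteTilde 𝕜 k)
  have hzero (k : Fin n → ℕ) : ∫ y, g y * ((hermiteTilde k y : ℝ) : 𝕜) ∂(gammaInv n) = 0 := by
    rw [← inner_hermiteL2, h]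
  have hre : (fun y => RCLike.re (g y)) =ᵐ[gammaInv n] 0 :=
    ae_eq_zero_of_integral_mul_hermiteTilde hg.re fun k => by
      simpa only [RCLike.re_mul_ofReal, hzero, map_zero] using integral_re (hint k)
  have him : (fun y => RCLike.im (g y)) =ᵐ[gammaInv n] 0 :=
    ae_eq_zero_of_integral_mul_hermiteTilde hg.im fun k => by
      simpa only [RCLike.im_mul_ofReal, hzero, map_zero] using integral_im (hint k)
  rw [Lp.eq_zero_iff_ae_eq_zero]
  filter_upwards [hre, him] with y hy_re hy_im
  exact RCLike.ext (by simpa using hy_re) (by simpa using hy_im)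

theorem coeff_eq_inner_div_norm_sq (f : Lp 𝕜 2 (gammaInv n)) (k : Fin n → ℕ) :
    coeff f k = inner 𝕜 (hermiteL2 𝕜 k) f / ((‖hermiteL2 𝕜 k‖ ^ 2 : ℝ) : 𝕜) := by
  have hweight (y : E n) : (√π ^ n * exp (‖y‖ ^ 2)) • (f y * ((hermiteTilde k y : ℝ) : 𝕜)) =
      ((√π ^ n : ℝ) : 𝕜) * (f y * ((hermiteTilde k y * exp (‖y‖ ^ 2) : ℝ) : 𝕜)) := by
    rw [RCLike.real_smul_eq_coe_mul]
    push_cast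
    ring
  rw [inner_hermiteL2, integral_gammaInv, coeff]
  simp only [hweight]
  rw [integral_const_mul, pi_rpow_half]
  push_cast
  ring

theorem hasSum_coeff_smul_hermiteL2 (g : Lp 𝕜 2 (gammaInv n)) :
    HasSum (fun k => coeff g k • hermiteL2 𝕜 k) g := by
  simpa only [coeff_eq_inner_div_norm_sq] using hasSum_inner_div_norm_sq_smul hermiteL2_ne_zero
    (fun _ _ => inner_hermiteL2_of_ne) (fun _ => eq_zero_of_inner_hermiteL2_eq_zero) g

end HermiteExpansion

section HermiteMultiplier

theorem integralOp_negPowKernel {F : Type*} [NormedAddCommGroup F] [NormedSpace ℝ F]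
    [CompleteSpace F] (β : ℝ) {f : E n → F} (hf : StronglyMeasurable f) {x : E n}
    (hx : lintegralOp (gammaInv n) (negPowKernel β) (fun y => ‖f y‖ₑ) x < ∞) :
    integralOp (gammaInv n) (negPowKernel β) f x =
      ∫ t, ∫ y, mehler (exp (-t)) x y • f y ∂(gammaInv n) ∂(riemannLiouville β) := by
  have hmehler : Measurable fun z : E n × ℝ => mehler (exp (-z.2)) x z.1 :=
    measurable_mehler.comp (f := fun z : E n × ℝ => (exp (-z.2), x, z.1)) (by fun_prop)
  have hmeas : StronglyMeasurable fun z : E n × ℝ => mehler (exp (-z.2)) x z.1 • f z.1 :=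
    hmehler.stronglyMeasurable.smul (hf.comp_measurable measurable_fst)
  have hint : Integrable (fun z : E n × ℝ => mehler (exp (-z.2)) x z.1 • f z.1)
      ((gammaInv n).prod (riemannLiouville β)) := by
    refine ⟨hmeas.aestronglyMeasurable, lt_of_eq_of_lt ?_ hx⟩
    rw [lintegral_prod _ hmeas.enorm.aemeasurable]
    refine lintegral_congr fun y => ?_
    have hy : Measurable fun t => semigroupKernel t x y :=
      measurable_semigroupKernel measurable_id measurable_const measurable_const
    rw [negPowKernel, ← lintegral_mul_const _ hy]
    refine lintegral_congr fun t => ?_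
    rw [enorm_smul, Real.enorm_of_nonneg (mehler_nonneg (exp_pos _).le x y), semigroupKernel]
  rw [← integral_integral_swap hint]
  refine integral_congr_ae (.of_forall fun y => ?_)
  dsimp only
  rw [toReal_negPowKernel, integral_smul_const]

variable {𝕜 : Type*} [RCLike 𝕜]

theorem integral_mehler_smul_hermiteTilde {t : ℝ} (ht : 0 < t) (k : Fin n → ℕ) (x : E n) :
    ∫ y, mehler (exp (-t)) x y • ((hermiteTilde k y : ℝ) : 𝕜) ∂(gammaInv n) =
      ((exp (-(((∑ i, k i : ℕ) : ℝ) + n) * t) * hermiteTilde k x : ℝ) : 𝕜) := by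
  have hexp : exp (-(((∑ i, k i : ℕ) : ℝ) + n) * t) = exp (-t) ^ ((∑ i, k i) + n) := by
    rw [← exp_nat_mul]
    push_cast
    ring_nf
  rw [hexp, ← integral_mehler_mul_hermiteTilde (exp_pos _) (exp_lt_one_iff.2 (neg_lt_zero.2 ht)),
    ← integral_ofReal]
  simp only [RCLike.real_smul_eq_coe_mul, RCLike.ofReal_mul]

theorem integralOp_negPowKernel_hermiteTilde (hn : 0 < n) {β : ℝ} (hβ : 0 < β) (k : Fin n → ℕ)
    {x : E n} (hx : lintegralOp (gammaInv n) (negPowKernel β)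
      (fun y => ‖((hermiteTilde k y : ℝ) : 𝕜)‖ₑ) x < ∞) :
    integralOp (gammaInv n) (negPowKernel β) (fun y => ((hermiteTilde k y : ℝ) : 𝕜)) x =
      (((((∑ i, k i : ℕ) : ℝ) + n) ^ β)⁻¹ : ℝ) * ((hermiteTilde k x : ℝ) : 𝕜) := by
  have hmeas : StronglyMeasurable fun y : E n => ((hermiteTilde k y : ℝ) : 𝕜) :=
    (RCLike.continuous_ofReal.comp (continuous_hermiteTilde k)).stronglyMeasurable
  have hsemigroup : ∀ᵐ t ∂(riemannLiouville β),
      ∫ y, mehler (exp (-t)) x y • ((hermiteTilde k y : ℝ) : 𝕜) ∂(gammaInv n) =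
        ((exp (-(((∑ i, k i : ℕ) : ℝ) + n) * t) * hermiteTilde k x : ℝ) : 𝕜) :=
    (ae_pos_riemannLiouville β).mono fun t ht => integral_mehler_smul_hermiteTilde ht k x
  rw [integralOp_negPowKernel β hmeas hx, integral_congr_ae hsemigroup, integral_ofReal,
    integral_mul_const, integral_exp_riemannLiouville hβ (by positivity), RCLike.ofReal_mul]

theorem map_hermiteL2_of_ae_eq_integralOp (hn : 0 < n) {β : ℝ} (hβ : 0 < β)
    {T : Lp 𝕜 2 (gammaInv n) → Lp 𝕜 2 (gammaInv n)}
    (hT : ∀ f, T f =ᵐ[gammaInv n] integralOp (gammaInv n) (negPowKernel β) f)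
    (k : Fin n → ℕ) :
    T (hermiteL2 𝕜 k) = ((((((∑ i, k i : ℕ) : ℝ) + n) ^ β)⁻¹ : ℝ) : 𝕜) • hermiteL2 𝕜 k := by
  obtain ⟨C, hC⟩ := exists_hasStrongType_negPowKernel hn hβ ENNReal.one_lt_two
    ENNReal.ofNat_ne_top
  have hmem := memLp_hermiteTilde 𝕜 k
  have hmeas : Measurable fun y : E n => ((hermiteTilde k y : ℝ) : 𝕜) :=
    (RCLike.continuous_ofReal.comp (continuous_hermiteTilde k)).measurable
  have hfin := hC.ae_lintegralOp_lt_top (measurable_negPowKernel β) two_ne_zero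
    ENNReal.ofNat_ne_top hmeas.enorm ((eLpNorm_enorm _).trans_lt hmem.2)
  have hTk := hT (hermiteL2 𝕜 k)
  rw [integralOp_congr_ae (coeFn_hermiteL2 k)] at hTk
  refine Lp.ext ?_
  filter_upwards [hTk, Lp.coeFn_smul ((((((∑ i, k i : ℕ) : ℝ) + n) ^ β)⁻¹ : ℝ) : 𝕜)
    (hermiteL2 𝕜 k), coeFn_hermiteL2 (𝕜 := 𝕜) k, hfin] with x hTx hsmul hk hx
  rw [hTx, hsmul, Pi.smul_apply, hk, smul_eq_mul,
    integralOp_negPowKernel_hermiteTilde hn hβ k hx]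

theorem hasSum_negPowTerm (hn : 0 < n) {β : ℝ} (hβ : 0 < β)
    {T : Lp 𝕜 2 (gammaInv n) →L[𝕜] Lp 𝕜 2 (gammaInv n)}
    (hT : ∀ f, T f =ᵐ[gammaInv n] integralOp (gammaInv n) (negPowKernel β) f)
    (g : Lp 𝕜 2 (gammaInv n)) : HasSum (negPowTerm β g) (T g) := by
  convert! (hasSum_coeff_smul_hermiteL2 g).mapL T using 2 with k
  rw [map_smul, map_hermiteL2_of_ae_eq_integralOp hn hβ hT, smul_smul, negPowTerm,
    RCLike.ofReal_inv, div_eq_mul_inv]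

end HermiteMultiplier

end
end InverseGauss

theorem proposition2p1 {𝕜 : Type*} [RCLike 𝕜] (n : ℕ) (hn : 0 < n) (β : ℝ) (hβ : 0 < β) :
    -- the series that defines `𝒜^{-β} f` converges in `L²(γ₋₁)`
    (∀ f : Lp 𝕜 2 (InverseGauss.gammaInv n), Summable (InverseGauss.negPowTerm β f)) ∧
    -- `𝒜^{-β}` extends from `L^p ∩ L²` to a bounded linear operator on `L^p`, `1 < p < ∞`
    (∀ (p : ℝ≥0∞) [Fact (1 ≤ p)], 1 < p → p < ∞ →
      ∃ T : Lp 𝕜 p (InverseGauss.gammaInv n) →L[𝕜] Lp 𝕜 p (InverseGauss.gammaInv n),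
        ∀ (f : Lp 𝕜 p (InverseGauss.gammaInv n)) (g : Lp 𝕜 2 (InverseGauss.gammaInv n)),
          f =ᵐ[InverseGauss.gammaInv n] g →
            T f =ᵐ[InverseGauss.gammaInv n] InverseGauss.negPow β g) ∧
    -- `𝒜^{-β}` extends from `L¹ ∩ L²` to a bounded linear operator from `L¹` into `L^{1,∞}`
    (∃ T : Lp 𝕜 1 (InverseGauss.gammaInv n) →ₗ[𝕜]
        (EuclideanSpace ℝ (Fin n) →ₘ[InverseGauss.gammaInv n] 𝕜),
      (∃ C : ℝ≥0, ∀ (f : Lp 𝕜 1 (InverseGauss.gammaInv n)) (s : ℝ), 0 < s →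
        InverseGauss.gammaInv n {x | s < ‖T f x‖} ≤ ENNReal.ofReal (C * ‖f‖ / s)) ∧
      ∀ (f : Lp 𝕜 1 (InverseGauss.gammaInv n)) (g : Lp 𝕜 2 (InverseGauss.gammaInv n)),
        f =ᵐ[InverseGauss.gammaInv n] g →
          T f =ᵐ[InverseGauss.gammaInv n] InverseGauss.negPow β g) := by
  have hK := InverseGauss.measurable_negPowKernel (n := n) β
  obtain ⟨_, h2⟩ := InverseGauss.exists_hasStrongType_negPowKernel hn hβ ENNReal.one_lt_two
    ENNReal.ofNat_ne_top
  obtain ⟨_, h1⟩ := InverseGauss.exists_hasWeakTypeOne_negPowKernel hn hβ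
  obtain ⟨T₂, hT₂⟩ := h2.exists_continuousLinearMap 𝕜 𝕜 hK ENNReal.ofNat_ne_top
  have hsum := InverseGauss.hasSum_negPowTerm hn hβ hT₂
  have hneg {f : EuclideanSpace ℝ (Fin n) → 𝕜} {g : Lp 𝕜 2 (InverseGauss.gammaInv n)}
      (hfg : f =ᵐ[InverseGauss.gammaInv n] g) :
      InverseGauss.integralOp (InverseGauss.gammaInv n) (InverseGauss.negPowKernel β) f
        =ᵐ[InverseGauss.gammaInv n] InverseGauss.negPow β g := by
    rw [InverseGauss.integralOp_congr_ae hfg, InverseGauss.negPow, (hsum g).tsum_eq]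
    exact (hT₂ g).symm
  refine ⟨fun g => (hsum g).summable, fun p _ hp1 hp => ?_, ?_⟩
  · obtain ⟨_, h⟩ := InverseGauss.exists_hasStrongType_negPowKernel hn hβ hp1 hp.ne
    obtain ⟨T, hT⟩ := h.exists_continuousLinearMap 𝕜 𝕜 hK hp.ne
    exact ⟨T, fun f g hfg => (hT f).trans (hneg hfg)⟩
  · obtain ⟨T, hweak, hT⟩ := h1.exists_linearMap 𝕜 𝕜 hK
    exact ⟨T, ⟨_, hweak⟩, fun f g hfg => (hT f).trans (hneg hfg)⟩
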